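/- A \emph{weighted oriented one-foam} is a finite oriented graph (circles without vertices are allowed as components) whose vertices are trivalent, each being either a \emph{merge} (two thin edges in, one thick edge out) or a \emph{split} (one thick edge in, two thin edges out), together with an order of the two thin edges at each vertex and a weight in $\mathbb R_{>0}$ on each edge such that at each vertex the weights of the thin edges add up to the weight of the thick edge. A \emph{weighted oriented two-foam} is a compact two-dimensional combinatorial complex with oriented weighted facets. Along each of its seams two ordered thin facets, inducing the same direction on the seam, flow into a thick facet, which induces the opposite direction; the weights of the thin facets add up to that of the thick one. At each of its vertices six facets $f_1,f_2,f_3,f_{12},f_{23},f_{123}$ meet along four seams with (thin, thin; thick) facets $(f_1,f_2;f_{12})$, $(f_2,f_3;f_{23})$, $(f_{12},f_3;f_{123})$, $(f_1,f_{23};f_{123})$, with the thin facets either all ordered as listed or all ordered in the opposite way. Its boundary is a weighted oriented one-foam. One-foams $U_0,U_1$ are \emph{cobordant} if $(-U_0)\sqcup U_1$ bounds a weighted oriented two-foam; the cobordism classes form an abelian group $\mathsf{Cob}^1_{>0}$ under disjoint union, with inverse given by orientation reversal. For $r\ge 1$, $\lambda_1,\dots,\lambda_r>0$ with $\sum_i\lambda_i=1$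 and $\sigma\in S_r$, let $T_{\lambda,\sigma}:[0,1)\to[0,1)$ be the interval exchange transformation that cuts $[0,1)$ into consecutive half-open intervals of lengths $\lambda_1,\dots,\lambda_r$ and makes the $i$-th interval $\sigma(i)$-th in the new order. Let $\mathsf{Aut}_{\mathsf{IET}}$ be the group of all these bijections under composition. The closed one-foam $\widehat F_{\lambda,\sigma}$ is obtained from a line of weight $1$ by splitting it, through any sequence of binary splits, into lines of weights $\lambda_1,\dots,\lambda_r$ from left to right, permuting these lines by $\sigma$, merging them, through any sequence of binary merges of neighbours, into a line of weight $1$, and closing up this line with the initial one; thin edges are ordered from left to right. \textbf{Proposition.} (1) If $T_{\lambda'',\sigma''}=T_{\lambda',\sigma'}\circ T_{\lambda,\sigma}$, then $\widehat F_{\lambda'',\sigma''}$ is cobordant to $\widehat F_{\lambda,\sigma}\sqcup\widehat F_{\lambda',\sigma'}$, for all choices of the sequences of splits and merges. (2) There is a group homomorphism $\phi':\mathsf{Aut}_{\mathsf{IET}}\to\mathsf{Cob}^1_{>0}$ with $\phi'(T_{\lambda,\sigma})=[\widehat F_{\lambda,\sigma}]$ for all $(\lambda,\sigma)$ and all choices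 of the sequences of splits and merges. -/

import Mathlib

/-! ### Weighted oriented one-foams -/

/-- A closed weighted (that is, `ℝ_{>0}`-decorated) oriented one-foam, as a finite combinatorial
complex: a finite oriented graph, with loops and multiple edges allowed, in which every vertex is
* a bivalent point (`Reg`; one edge comes in, one goes out), which is only a marking on a line or
  on a circle, so that a circle without vertices is an edge whose two ends meet in such a point;
* a merge vertex (`Merge`), with an ordered pair of thin edges coming in and a thick edge going
  out; or
* a split vertex (`Split`), with a thick edge coming in and an ordered pair of thin edges going
  out.
Each edge carries a positive weight; weights add at the vertices. -/
structure OneFoam where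
  Edge : Type
  Reg : Type
  Merge : Type
  Split : Type
  [finite_edge : Finite Edge]
  [finite_reg : Finite Reg]
  [finite_merge : Finite Merge]
  [finite_split : Finite Split]
  weight : Edge → ℝ
  weight_pos : ∀ e, 0 < weight e
  regIn : Reg → Edge
  regOut : Reg → Edge
  mergeIn₁ : Merge → Edge
  mergeIn₂ : Merge → Edge
  mergeOut : Merge → Edge
  splitIn : Split → Edge
  splitOut₁ : Split → Edge
  splitOut₂ : Split → Edge
  /-- every edge has exactly one terminal end -/
  target_bij : Function.Bijective
    (Sum.elim regIn (Sum.elim mergeIn₁ (Sum.elim mergeIn₂ splitIn)))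
  /-- every edge has exactly one initial end -/
  source_bij : Function.Bijective
    (Sum.elim regOut (Sum.elim splitOut₁ (Sum.elim splitOut₂ mergeOut)))
  reg_weight : ∀ r, weight (regIn r) = weight (regOut r)
  merge_weight : ∀ m, weight (mergeIn₁ m) + weight (mergeIn₂ m) = weight (mergeOut m)
  split_weight : ∀ s, weight (splitOut₁ s) + weight (splitOut₂ s) = weight (splitIn s)

namespace OneFoam

attribute [instance] OneFoam.finite_edge OneFoam.finite_reg OneFoam.finite_merge
  OneFoam.finite_split

/-- The empty one-foam. -/
def empty : OneFoam where
  Edge := Empty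
  Reg := Empty
  Merge := Empty
  Split := Empty
  weight := Empty.elim
  weight_pos := fun e => e.elim
  regIn := Empty.elim
  regOut := Empty.elim
  mergeIn₁ := Empty.elim
  mergeIn₂ := Empty.elim
  mergeOut := Empty.elim
  splitIn := Empty.elim
  splitOut₁ := Empty.elim
  splitOut₂ := Empty.elim
  target_bij := ⟨by rintro (x | x | x | x) <;> exact x.elim, fun e => e.elim⟩
  source_bij := ⟨by rintro (x | x | x | x) <;> exact x.elim, fun e => e.elim⟩
  reg_weight := fun e => e.elim
  merge_weight := fun e => e.elim
  split_weight := fun e => e.elim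

/-- The one-foam `-U`: all edges are reversed, so that merges become splits and vice versa; the
order of the two thin edges at each vertex and the weights stay the same. -/
def reverse (U : OneFoam) : OneFoam where
  Edge := U.Edge
  Reg := U.Reg
  Merge := U.Split
  Split := U.Merge
  weight := U.weight
  weight_pos := U.weight_pos
  regIn := U.regOut
  regOut := U.regIn
  mergeIn₁ := U.splitOut₁
  mergeIn₂ := U.splitOut₂
  mergeOut := U.splitIn
  splitIn := U.mergeOut
  splitOut₁ := U.mergeIn₁
  splitOut₂ := U.mergeIn₂
  target_bij := U.source_bij
  source_bij := U.target_bij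
  reg_weight := fun r => (U.reg_weight r).symm
  merge_weight := U.split_weight
  split_weight := U.merge_weight

/-- Bookkeeping for disjoint unions. -/
theorem bij_sum {A B C D E A' B' C' D' E' : Type} {a : A → E} {b : B → E} {c : C → E} {d : D → E}
    {a' : A' → E'} {b' : B' → E'} {c' : C' → E'} {d' : D' → E'}
    (h : Function.Bijective (Sum.elim a (Sum.elim b (Sum.elim c d))))
    (h' : Function.Bijective (Sum.elim a' (Sum.elim b' (Sum.elim c' d')))) :
    Function.Bijective (Sum.elim (Sum.map a a') (Sum.elim (Sum.map b b')
      (Sum.elim (Sum.map c c') (Sum.map d d')))) := by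
  let e : (A ⊕ A') ⊕ ((B ⊕ B') ⊕ ((C ⊕ C') ⊕ (D ⊕ D'))) ≃
      (A ⊕ (B ⊕ (C ⊕ D))) ⊕ (A' ⊕ (B' ⊕ (C' ⊕ D'))) :=
    (Equiv.sumCongr (Equiv.refl _) ((Equiv.sumCongr (Equiv.refl _)
      (Equiv.sumSumSumComm _ _ _ _)).trans (Equiv.sumSumSumComm _ _ _ _))).trans
      (Equiv.sumSumSumComm _ _ _ _)
  have hb := (Function.Bijective.sumMap h h').comp e.bijective
  convert hb using 1
  funext x
  rcases x with (x | x) | (x | x) | (x | x) | (x | x) <;> rfl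

/-- The disjoint union of two one-foams. -/
def union (U V : OneFoam) : OneFoam where
  Edge := U.Edge ⊕ V.Edge
  Reg := U.Reg ⊕ V.Reg
  Merge := U.Merge ⊕ V.Merge
  Split := U.Split ⊕ V.Split
  weight := Sum.elim U.weight V.weight
  weight_pos := by rintro (e | e); exacts [U.weight_pos e, V.weight_pos e]
  regIn := Sum.map U.regIn V.regIn
  regOut := Sum.map U.regOut V.regOut
  mergeIn₁ := Sum.map U.mergeIn₁ V.mergeIn₁
  mergeIn₂ := Sum.map U.mergeIn₂ V.mergeIn₂
  mergeOut := Sum.map U.mergeOut V.mergeOut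
  splitIn := Sum.map U.splitIn V.splitIn
  splitOut₁ := Sum.map U.splitOut₁ V.splitOut₁
  splitOut₂ := Sum.map U.splitOut₂ V.splitOut₂
  target_bij := bij_sum U.target_bij V.target_bij
  source_bij := bij_sum U.source_bij V.source_bij
  reg_weight := by rintro (e | e); exacts [U.reg_weight e, V.reg_weight e]
  merge_weight := by rintro (e | e); exacts [U.merge_weight e, V.merge_weight e]
  split_weight := by rintro (e | e); exacts [U.split_weight e, V.split_weight e]

/-- Isomorphisms of one-foams (used only to prove the group laws below). -/
structure Iso (U V : OneFoam) where
  edge : U.Edge ≃ V.Edge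
  reg : U.Reg ≃ V.Reg
  merge : U.Merge ≃ V.Merge
  split : U.Split ≃ V.Split
  weight : ∀ e, V.weight (edge e) = U.weight e
  regIn : ∀ x, V.regIn (reg x) = edge (U.regIn x)
  regOut : ∀ x, V.regOut (reg x) = edge (U.regOut x)
  mergeIn₁ : ∀ x, V.mergeIn₁ (merge x) = edge (U.mergeIn₁ x)
  mergeIn₂ : ∀ x, V.mergeIn₂ (merge x) = edge (U.mergeIn₂ x)
  mergeOut : ∀ x, V.mergeOut (merge x) = edge (U.mergeOut x)
  splitIn : ∀ x, V.splitIn (split x) = edge (U.splitIn x)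
  splitOut₁ : ∀ x, V.splitOut₁ (split x) = edge (U.splitOut₁ x)
  splitOut₂ : ∀ x, V.splitOut₂ (split x) = edge (U.splitOut₂ x)

end OneFoam

/-! ### Weighted oriented two-foams -/

/-- The six facets `f₁, f₂, f₃, f₁₂, f₂₃, f₁₂₃` at a vertex of a two-foam fit together along the
four seams `a, b, c, d` there. The triples (first thin, second thin, thick facet) along the seams
are `(f₁, f₂, f₁₂)` for `a`, `(f₂, f₃, f₂₃)` for `b`, `(f₁₂, f₃, f₁₂₃)` for `c` and
`(f₁, f₂₃, f₁₂₃)` for `d`. -/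
def VertexMatch {Seam Facet : Type} (thin₁ thin₂ thick : Seam → Facet) (a b c d : Seam) : Prop :=
  thin₁ a = thin₁ d ∧ thin₂ a = thin₁ b ∧ thin₂ b = thin₂ c ∧
    thick a = thin₁ c ∧ thick b = thin₂ d ∧ thick c = thick d

/-- A compact weighted oriented two-foam with boundary (identified with) the one-foam `U`,
described combinatorially by its seams, its vertices and its facets.

Facets. A facet is (the interior of) a compact connected oriented surface, and hence is given by
its genus and by its boundary circles. The boundary circles are subdivided into sides; a side runs
either along a seam or along an edge of `U`. Along each seam there are three sides, which belong to
the first thin, the second thin and the thick facet. `thin₁`, `thin₂`, `thick` and `side` record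
the facet to which a side belongs. Sides are directed by the boundary orientation of their facet.

Seams. The two thin facets induce the same direction on the seam, and the thick one induces the
opposite direction (each thin facet flows into the thick facet). A seam is directed like its two
thin sides. Its terminal end and its initial end lie at
* a bivalent point of the seam (`Point`), a mere marking, where a seam ends and a seam starts; a
  seam circle without vertices is a seam with one such point on it;
* a vertex. There are two kinds of vertices up to isomorphism. With the notation of `VertexMatch`,
  at a vertex in `VertP` the seams `a, c` end and the seams `b, d` start; at a vertex in `VertN`
  all facet orientations are opposite, so that `a, c` start and `b, d` end. (Reversing the
  order of the thin facets along all four seams exchanges the two kinds.)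
* a vertex of the boundary `U`: seams end at the splits of `U` and start at its merges.

Where two sides meet. At each of these points every arriving side is followed by the departing side
in the same corner. So the cyclic sequences of sides that bound the facets are determined by the
kinds of points, and what has to be required is that two consecutive sides belong to the same
facet. -/
structure TwoFoam (U : OneFoam) where
  Facet : Type
  Seam : Type
  Point : Type
  VertP : Type
  VertN : Type
  [finite_facet : Finite Facet]
  [finite_seam : Finite Seam]
  [finite_point : Finite Point]
  [finite_vertP : Finite VertP]
  [finite_vertN : Finite VertN]
  genus : Facet → ℕ
  weight : Facet → ℝ
  weight_pos : ∀ f, 0 < weight f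
  thin₁ : Seam → Facet
  thin₂ : Seam → Facet
  thick : Seam → Facet
  seam_weight : ∀ s, weight (thin₁ s) + weight (thin₂ s) = weight (thick s)
  side : U.Edge → Facet
  side_weight : ∀ e, weight (side e) = U.weight e
  pointIn : Point → Seam
  pointOut : Point → Seam
  aP : VertP → Seam
  bP : VertP → Seam
  cP : VertP → Seam
  dP : VertP → Seam
  aN : VertN → Seam
  bN : VertN → Seam
  cN : VertN → Seam
  dN : VertN → Seam
  atSplit : U.Split → Seam
  atMerge : U.Merge → Seam
  /-- every seam has exactly one terminal end -/
  target_bij : Function.Bijective (Sum.elim pointIn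
    (Sum.elim aP (Sum.elim cP (Sum.elim bN (Sum.elim dN atSplit)))))
  /-- every seam has exactly one initial end -/
  source_bij : Function.Bijective (Sum.elim pointOut
    (Sum.elim aN (Sum.elim cN (Sum.elim bP (Sum.elim dP atMerge)))))
  /-- the facets continue along the seam, in the same order -/
  point_match : ∀ p, thin₁ (pointIn p) = thin₁ (pointOut p) ∧
    thin₂ (pointIn p) = thin₂ (pointOut p) ∧ thick (pointIn p) = thick (pointOut p)
  vertP_match : ∀ v, VertexMatch thin₁ thin₂ thick (aP v) (bP v) (cP v) (dP v)
  vertN_match : ∀ v, VertexMatch thin₁ thin₂ thick (aN v) (bN v) (cN v) (dN v)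
  reg_match : ∀ r, side (U.regIn r) = side (U.regOut r)
  merge_match : ∀ m, side (U.mergeIn₁ m) = thin₁ (atMerge m) ∧
    side (U.mergeIn₂ m) = thin₂ (atMerge m) ∧ side (U.mergeOut m) = thick (atMerge m)
  split_match : ∀ s, side (U.splitOut₁ s) = thin₁ (atSplit s) ∧
    side (U.splitOut₂ s) = thin₂ (atSplit s) ∧ side (U.splitIn s) = thick (atSplit s)

/-- A cobordism from `U` to `V` is a two-foam with boundary `(-U) ⊔ V`; two one-foams are
cobordant if there is one. -/
def Cobordant (U V : OneFoam) : Prop :=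
  Nonempty (TwoFoam (U.reverse.union V))

namespace TwoFoam

attribute [instance] TwoFoam.finite_facet TwoFoam.finite_seam TwoFoam.finite_point
  TwoFoam.finite_vertP TwoFoam.finite_vertN

/-- Change the boundary by an isomorphism. -/
def transport {U V : OneFoam} (i : U.Iso V) (F : TwoFoam U) : TwoFoam V where
  Facet := F.Facet
  Seam := F.Seam
  Point := F.Point
  VertP := F.VertP
  VertN := F.VertN
  genus := F.genus
  weight := F.weight
  weight_pos := F.weight_pos
  thin₁ := F.thin₁
  thin₂ := F.thin₂
  thick := F.thick
  seam_weight := F.seam_weight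
  side := fun e => F.side (i.edge.symm e)
  side_weight := fun e => by rw [F.side_weight, ← i.weight, Equiv.apply_symm_apply]
  pointIn := F.pointIn
  pointOut := F.pointOut
  aP := F.aP
  bP := F.bP
  cP := F.cP
  dP := F.dP
  aN := F.aN
  bN := F.bN
  cN := F.cN
  dN := F.dN
  atSplit := fun s => F.atSplit (i.split.symm s)
  atMerge := fun s => F.atMerge (i.merge.symm s)
  target_bij := by
    have := F.target_bij.comp (Equiv.sumCongr (Equiv.refl _) (Equiv.sumCongr (Equiv.refl _)
      (Equiv.sumCongr (Equiv.refl _) (Equiv.sumCongr (Equiv.refl _) (Equiv.sumCongr (Equiv.refl _)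
      i.split.symm))))).bijective
    convert this using 1
    funext x
    rcases x with x | x | x | x | x | x <;> rfl
  source_bij := by
    have := F.source_bij.comp (Equiv.sumCongr (Equiv.refl _) (Equiv.sumCongr (Equiv.refl _)
      (Equiv.sumCongr (Equiv.refl _) (Equiv.sumCongr (Equiv.refl _) (Equiv.sumCongr (Equiv.refl _)
      i.merge.symm))))).bijective
    convert this using 1
    funext x
    rcases x with x | x | x | x | x | x <;> rfl
  point_match := F.point_match
  vertP_match := F.vertP_match
  vertN_match := F.vertN_match
  reg_match := fun r => by
    obtain ⟨r, rfl⟩ := i.reg.surjective r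
    simpa [i.regIn, i.regOut] using F.reg_match r
  merge_match := fun r => by
    obtain ⟨r, rfl⟩ := i.merge.surjective r
    simpa [i.mergeIn₁, i.mergeIn₂, i.mergeOut] using F.merge_match r
  split_match := fun r => by
    obtain ⟨r, rfl⟩ := i.split.surjective r
    simpa [i.splitOut₁, i.splitOut₂, i.splitIn] using F.split_match r

/-- Reverse the orientations of all facets. -/
def reverse {U : OneFoam} (F : TwoFoam U) : TwoFoam U.reverse where
  Facet := F.Facet
  Seam := F.Seam
  Point := F.Point
  VertP := F.VertN
  VertN := F.VertP
  genus := F.genus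
  weight := F.weight
  weight_pos := F.weight_pos
  thin₁ := F.thin₁
  thin₂ := F.thin₂
  thick := F.thick
  seam_weight := F.seam_weight
  side := F.side
  side_weight := F.side_weight
  pointIn := F.pointOut
  pointOut := F.pointIn
  aP := F.aN
  bP := F.bN
  cP := F.cN
  dP := F.dN
  aN := F.aP
  bN := F.bP
  cN := F.cP
  dN := F.dP
  atSplit := F.atMerge
  atMerge := F.atSplit
  target_bij := F.source_bij
  source_bij := F.target_bij
  point_match := fun p => by simpa [eq_comm] using F.point_match p
  vertP_match := F.vertN_match
  vertN_match := F.vertP_match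
  reg_match := fun r => (F.reg_match r).symm
  merge_match := F.split_match
  split_match := F.merge_match

/-- Bookkeeping for disjoint unions and gluings. -/
theorem bij_sum {A B C D E G A' B' C' D' E' G' S S' : Type} {a : A → S} {b : B → S} {c : C → S}
    {d : D → S} {e : E → S} {g : G → S} {a' : A' → S'} {b' : B' → S'} {c' : C' → S'} {d' : D' → S'}
    {e' : E' → S'} {g' : G' → S'}
    (h : Function.Bijective (Sum.elim a (Sum.elim b (Sum.elim c (Sum.elim d (Sum.elim e g))))))
    (h' : Function.Bijective
      (Sum.elim a' (Sum.elim b' (Sum.elim c' (Sum.elim d' (Sum.elim e' g')))))) :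
    Function.Bijective (Sum.elim (Sum.map a a') (Sum.elim (Sum.map b b')
      (Sum.elim (Sum.map c c') (Sum.elim (Sum.map d d') (Sum.elim (Sum.map e e')
        (Sum.map g g')))))) := by
  have hb := (Function.Bijective.sumMap h h').comp
    ((Equiv.sumCongr (Equiv.refl _) ((Equiv.sumCongr (Equiv.refl _)
      ((Equiv.sumCongr (Equiv.refl _) ((Equiv.sumCongr (Equiv.refl _)
      (Equiv.sumSumSumComm _ _ _ _)).trans (Equiv.sumSumSumComm _ _ _ _))).trans
      (Equiv.sumSumSumComm _ _ _ _))).trans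
      (Equiv.sumSumSumComm _ _ _ _))).trans
      (Equiv.sumSumSumComm _ _ _ _)).bijective
  convert hb using 1
  funext x
  rcases x with (x | x) | (x | x) | (x | x) | (x | x) | (x | x) | (x | x) <;> rfl

theorem vertexMatch_map {S S' T T' : Type} {f₁ f₂ f₃ : S → T} {g₁ g₂ g₃ : S' → T'} {j : S → S'}
    {k : T → T'} (h₁ : ∀ s, g₁ (j s) = k (f₁ s)) (h₂ : ∀ s, g₂ (j s) = k (f₂ s))
    (h₃ : ∀ s, g₃ (j s) = k (f₃ s)) {a b c d : S} (h : VertexMatch f₁ f₂ f₃ a b c d) :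
    VertexMatch g₁ g₂ g₃ (j a) (j b) (j c) (j d) := by
  obtain ⟨e₁, e₂, e₃, e₄, e₅, e₆⟩ := h
  refine ⟨?_, ?_, ?_, ?_, ?_, ?_⟩ <;> simp only [h₁, h₂, h₃]
  exacts [congrArg k e₁, congrArg k e₂, congrArg k e₃, congrArg k e₄, congrArg k e₅, congrArg k e₆]

/-- The disjoint union of two-foams. -/
def union {U V : OneFoam} (F : TwoFoam U) (G : TwoFoam V) : TwoFoam (U.union V) where
  Facet := F.Facet ⊕ G.Facet
  Seam := F.Seam ⊕ G.Seam
  Point := F.Point ⊕ G.Point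
  VertP := F.VertP ⊕ G.VertP
  VertN := F.VertN ⊕ G.VertN
  genus := Sum.elim F.genus G.genus
  weight := Sum.elim F.weight G.weight
  weight_pos := by rintro (f | f); exacts [F.weight_pos f, G.weight_pos f]
  thin₁ := Sum.map F.thin₁ G.thin₁
  thin₂ := Sum.map F.thin₂ G.thin₂
  thick := Sum.map F.thick G.thick
  seam_weight := by rintro (f | f); exacts [F.seam_weight f, G.seam_weight f]
  side := Sum.map F.side G.side
  side_weight := by rintro (f | f); exacts [F.side_weight f, G.side_weight f]
  pointIn := Sum.map F.pointIn G.pointIn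
  pointOut := Sum.map F.pointOut G.pointOut
  aP := Sum.map F.aP G.aP
  bP := Sum.map F.bP G.bP
  cP := Sum.map F.cP G.cP
  dP := Sum.map F.dP G.dP
  aN := Sum.map F.aN G.aN
  bN := Sum.map F.bN G.bN
  cN := Sum.map F.cN G.cN
  dN := Sum.map F.dN G.dN
  atSplit := Sum.map F.atSplit G.atSplit
  atMerge := Sum.map F.atMerge G.atMerge
  target_bij := bij_sum F.target_bij G.target_bij
  source_bij := bij_sum F.source_bij G.source_bij
  point_match := by
    rintro (p | p)
    · simpa using F.point_match p
    · simpa using G.point_match p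
  vertP_match := by
    rintro (v | v)
    · exact vertexMatch_map (f₁ := F.thin₁) (f₂ := F.thin₂) (f₃ := F.thick) (j := Sum.inl)
        (k := Sum.inl) (fun _ => rfl) (fun _ => rfl) (fun _ => rfl) (F.vertP_match v)
    · exact vertexMatch_map (f₁ := G.thin₁) (f₂ := G.thin₂) (f₃ := G.thick) (j := Sum.inr)
        (k := Sum.inr) (fun _ => rfl) (fun _ => rfl) (fun _ => rfl) (G.vertP_match v)
  vertN_match := by
    rintro (v | v)
    · exact vertexMatch_map (f₁ := F.thin₁) (f₂ := F.thin₂) (f₃ := F.thick) (j := Sum.inl)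
        (k := Sum.inl) (fun _ => rfl) (fun _ => rfl) (fun _ => rfl) (F.vertN_match v)
    · exact vertexMatch_map (f₁ := G.thin₁) (f₂ := G.thin₂) (f₃ := G.thick) (j := Sum.inr)
        (k := Sum.inr) (fun _ => rfl) (fun _ => rfl) (fun _ => rfl) (G.vertN_match v)
  reg_match := by
    rintro (p | p)
    · exact congrArg Sum.inl (F.reg_match p)
    · exact congrArg Sum.inr (G.reg_match p)
  merge_match := by
    rintro (p | p)
    · have := F.merge_match p
      exact ⟨congrArg Sum.inl this.1, congrArg Sum.inl this.2.1, congrArg Sum.inl this.2.2⟩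
    · have := G.merge_match p
      exact ⟨congrArg Sum.inr this.1, congrArg Sum.inr this.2.1, congrArg Sum.inr this.2.2⟩
  split_match := by
    rintro (p | p)
    · have := F.split_match p
      exact ⟨congrArg Sum.inl this.1, congrArg Sum.inl this.2.1, congrArg Sum.inl this.2.2⟩
    · have := G.split_match p
      exact ⟨congrArg Sum.inr this.1, congrArg Sum.inr this.2.1, congrArg Sum.inr this.2.2⟩

/-- The facets of the product of a one-foam with an interval: its edges, up to bivalent points. -/
def cylRel (U : OneFoam) (e e' : U.Edge) : Prop := ∃ r, e = U.regIn r ∧ e' = U.regOut r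

/-- The product of a one-foam with an interval. -/
def cyl (U : OneFoam) : TwoFoam (U.reverse.union U) where
  Facet := Quot (cylRel U)
  Seam := U.Merge ⊕ U.Split
  Point := Empty
  VertP := Empty
  VertN := Empty
  genus := fun _ => 0
  weight := Quot.lift U.weight (by rintro _ _ ⟨r, rfl, rfl⟩; exact U.reg_weight r)
  weight_pos := by rintro ⟨e⟩; exact U.weight_pos e
  thin₁ := Sum.elim (fun m => Quot.mk _ (U.mergeIn₁ m)) (fun s => Quot.mk _ (U.splitOut₁ s))
  thin₂ := Sum.elim (fun m => Quot.mk _ (U.mergeIn₂ m)) (fun s => Quot.mk _ (U.splitOut₂ s))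
  thick := Sum.elim (fun m => Quot.mk _ (U.mergeOut m)) (fun s => Quot.mk _ (U.splitIn s))
  seam_weight := by rintro (m | s); exacts [U.merge_weight m, U.split_weight s]
  side := Sum.elim (Quot.mk _) (Quot.mk _)
  side_weight := by rintro (e | e) <;> rfl
  pointIn := Empty.elim
  pointOut := Empty.elim
  aP := Empty.elim
  bP := Empty.elim
  cP := Empty.elim
  dP := Empty.elim
  aN := Empty.elim
  bN := Empty.elim
  cN := Empty.elim
  dN := Empty.elim
  atSplit := id
  atMerge := Sum.swap
  target_bij := by
    refine ⟨?_, fun s => ⟨.inr (.inr (.inr (.inr (.inr s)))), rfl⟩⟩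
    rintro (x | x | x | x | x | x) (y | y | y | y | y | y) h <;>
      first | exact x.elim | exact y.elim | skip
    exact congrArg (fun z => Sum.inr (Sum.inr (Sum.inr (Sum.inr (Sum.inr z))))) h
  source_bij := by
    refine ⟨?_, fun s => ⟨.inr (.inr (.inr (.inr (.inr s.swap)))), Sum.swap_swap s⟩⟩
    rintro (x | x | x | x | x | x) (y | y | y | y | y | y) h <;>
      first | exact x.elim | exact y.elim | skip
    have h' : x = y := (Equiv.sumComm _ _).injective h
    rw [h']
  point_match := fun p => p.elim
  vertP_match := fun p => p.elim
  vertN_match := fun p => p.elim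
  reg_match := by
    rintro (r | r)
    · exact (Quot.sound ⟨r, rfl, rfl⟩).symm
    · exact Quot.sound ⟨r, rfl, rfl⟩
  merge_match := by rintro (m | m) <;> exact ⟨rfl, rfl, rfl⟩
  split_match := by rintro (m | m) <;> exact ⟨rfl, rfl, rfl⟩

/-- Facets of two cobordisms that meet along an edge of the one-foam between them. -/
inductive GlueRel {U V W : OneFoam} (F : TwoFoam (U.reverse.union V))
    (G : TwoFoam (V.reverse.union W)) : F.Facet ⊕ G.Facet → F.Facet ⊕ G.Facet → Prop
  | edge (e : V.Edge) : GlueRel F G (.inl (F.side (.inr e))) (.inr (G.side (.inl e)))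

theorem glue_bij {A B C D E G₁ G₂ A' B' C' D' E' G₁' G₂' S S' : Type} {a : A → S} {b : B → S}
    {c : C → S} {d : D → S} {e : E → S} {g : G₁ ⊕ G₂ → S} {a' : A' → S'} {b' : B' → S'}
    {c' : C' → S'} {d' : D' → S'} {e' : E' → S'} {g' : G₁' ⊕ G₂' → S'}
    (h : Function.Bijective (Sum.elim a (Sum.elim b (Sum.elim c (Sum.elim d (Sum.elim e g))))))
    (h' : Function.Bijective
      (Sum.elim a' (Sum.elim b' (Sum.elim c' (Sum.elim d' (Sum.elim e' g')))))) :
    Function.Bijective (Sum.elim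
      (Sum.elim (Sum.map a a') (Sum.elim (fun x => Sum.inl (g (.inr x)))
        (fun x => Sum.inr (g' (.inl x)))))
      (Sum.elim (Sum.map b b') (Sum.elim (Sum.map c c') (Sum.elim (Sum.map d d')
        (Sum.elim (Sum.map e e')
          (Sum.elim (fun x => Sum.inl (g (.inl x))) (fun x => Sum.inr (g' (.inr x))))))))) := by
  have hb := bij_sum h h'
  let k : ((A ⊕ A') ⊕ (G₂ ⊕ G₁')) ⊕ ((B ⊕ B') ⊕ ((C ⊕ C') ⊕ ((D ⊕ D') ⊕ ((E ⊕ E') ⊕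
      (G₁ ⊕ G₂'))))) ≃
      (A ⊕ A') ⊕ ((B ⊕ B') ⊕ ((C ⊕ C') ⊕ ((D ⊕ D') ⊕ ((E ⊕ E') ⊕
        ((G₁ ⊕ G₂) ⊕ (G₁' ⊕ G₂')))))) :=
    { toFun := fun x => match x with
        | .inl (.inl y) => .inl y
        | .inl (.inr (.inl y)) => .inr (.inr (.inr (.inr (.inr (.inl (.inr y))))))
        | .inl (.inr (.inr y)) => .inr (.inr (.inr (.inr (.inr (.inr (.inl y))))))
        | .inr (.inl y) => .inr (.inl y)
        | .inr (.inr (.inl y)) => .inr (.inr (.inl y))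
        | .inr (.inr (.inr (.inl y))) => .inr (.inr (.inr (.inl y)))
        | .inr (.inr (.inr (.inr (.inl y)))) => .inr (.inr (.inr (.inr (.inl y))))
        | .inr (.inr (.inr (.inr (.inr (.inl y))))) =>
            .inr (.inr (.inr (.inr (.inr (.inl (.inl y))))))
        | .inr (.inr (.inr (.inr (.inr (.inr y))))) =>
            .inr (.inr (.inr (.inr (.inr (.inr (.inr y))))))
      invFun := fun x => match x with
        | .inl y => .inl (.inl y)
        | .inr (.inr (.inr (.inr (.inr (.inl (.inr y)))))) => .inl (.inr (.inl y))
        | .inr (.inr (.inr (.inr (.inr (.inr (.inl y)))))) => .inl (.inr (.inr y))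
        | .inr (.inl y) => .inr (.inl y)
        | .inr (.inr (.inl y)) => .inr (.inr (.inl y))
        | .inr (.inr (.inr (.inl y))) => .inr (.inr (.inr (.inl y)))
        | .inr (.inr (.inr (.inr (.inl y)))) => .inr (.inr (.inr (.inr (.inl y))))
        | .inr (.inr (.inr (.inr (.inr (.inl (.inl y)))))) =>
            .inr (.inr (.inr (.inr (.inr (.inl y)))))
        | .inr (.inr (.inr (.inr (.inr (.inr (.inr y)))))) =>
            .inr (.inr (.inr (.inr (.inr (.inr y)))))
      left_inv := by
        rintro (((x | x) | (x | x)) | (x | x | x | x | x | x)) <;> rfl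
      right_inv := by
        rintro (x | x | x | x | x | (x | x) | (x | x)) <;> rfl }
  convert hb.comp k.bijective using 1
  funext x
  rcases x with ((x | x) | (x | x)) | (x | x) | (x | x) | (x | x) | (x | x) | (x | x) <;> rfl

/-- Glue two cobordisms along the one-foam between them. Facets that meet along an edge of `V` are
joined; the seams that end at a vertex of `V` are joined at a bivalent point. (Only the existence
of some two-foam is used, and the genus of the joined facets is set to `0`.) -/
def glue {U V W : OneFoam} (F : TwoFoam (U.reverse.union V)) (G : TwoFoam (V.reverse.union W)) :
    TwoFoam (U.reverse.union W) where
  Facet := Quot (GlueRel F G)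
  Seam := F.Seam ⊕ G.Seam
  Point := (F.Point ⊕ G.Point) ⊕ (V.Split ⊕ V.Merge)
  VertP := F.VertP ⊕ G.VertP
  VertN := F.VertN ⊕ G.VertN
  genus := fun _ => 0
  weight := Quot.lift (Sum.elim F.weight G.weight) (by
    rintro _ _ ⟨e⟩
    exact (F.side_weight (.inr e)).trans (G.side_weight (.inl e)).symm)
  weight_pos := by rintro ⟨f | f⟩; exacts [F.weight_pos f, G.weight_pos f]
  thin₁ := fun s => Quot.mk _ (Sum.map F.thin₁ G.thin₁ s)
  thin₂ := fun s => Quot.mk _ (Sum.map F.thin₂ G.thin₂ s)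
  thick := fun s => Quot.mk _ (Sum.map F.thick G.thick s)
  seam_weight := by rintro (f | f); exacts [F.seam_weight f, G.seam_weight f]
  side := Sum.elim (fun e => Quot.mk _ (.inl (F.side (.inl e))))
    (fun e => Quot.mk _ (.inr (G.side (.inr e))))
  side_weight := by rintro (f | f); exacts [F.side_weight (.inl f), G.side_weight (.inr f)]
  pointIn := Sum.elim (Sum.map F.pointIn G.pointIn)
    (Sum.elim (fun s => .inl (F.atSplit (.inr s))) (fun m => .inr (G.atSplit (.inl m))))
  pointOut := Sum.elim (Sum.map F.pointOut G.pointOut)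
    (Sum.elim (fun s => .inr (G.atMerge (.inl s))) (fun m => .inl (F.atMerge (.inr m))))
  aP := Sum.map F.aP G.aP
  bP := Sum.map F.bP G.bP
  cP := Sum.map F.cP G.cP
  dP := Sum.map F.dP G.dP
  aN := Sum.map F.aN G.aN
  bN := Sum.map F.bN G.bN
  cN := Sum.map F.cN G.cN
  dN := Sum.map F.dN G.dN
  atSplit := Sum.elim (fun s => .inl (F.atSplit (.inl s))) (fun s => .inr (G.atSplit (.inr s)))
  atMerge := Sum.elim (fun s => .inl (F.atMerge (.inl s))) (fun s => .inr (G.atMerge (.inr s)))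
  target_bij := glue_bij F.target_bij G.target_bij
  source_bij := by
    have := (glue_bij F.source_bij G.source_bij).comp
      (Equiv.sumCongr (Equiv.sumCongr (Equiv.refl _) (Equiv.sumComm _ _))
        (Equiv.refl _)).bijective
    refine Eq.mp (congrArg Function.Bijective ?_) this
    funext x
    rcases x with ((x | x) | (x | x)) | (x | x) | (x | x) | (x | x) | (x | x) | (x | x) <;> rfl
  point_match := by
    rintro ((p | p) | (s | m))
    · have := F.point_match p
      exact ⟨congrArg (fun f => Quot.mk (GlueRel F G) (Sum.inl f)) this.1,
        congrArg (fun f => Quot.mk (GlueRel F G) (Sum.inl f)) this.2.1,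
        congrArg (fun f => Quot.mk (GlueRel F G) (Sum.inl f)) this.2.2⟩
    · have := G.point_match p
      exact ⟨congrArg (fun f => Quot.mk (GlueRel F G) (Sum.inr f)) this.1,
        congrArg (fun f => Quot.mk (GlueRel F G) (Sum.inr f)) this.2.1,
        congrArg (fun f => Quot.mk (GlueRel F G) (Sum.inr f)) this.2.2⟩
    · have hF := F.split_match (.inr s)
      have hG := G.merge_match (.inl s)
      refine ⟨?_, ?_, ?_⟩
      · exact (congrArg (fun f => Quot.mk (GlueRel F G) (Sum.inl f)) hF.1.symm).trans
          ((Quot.sound (GlueRel.edge (V.splitOut₁ s))).trans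
            (congrArg (fun f => Quot.mk (GlueRel F G) (Sum.inr f)) hG.1))
      · exact (congrArg (fun f => Quot.mk (GlueRel F G) (Sum.inl f)) hF.2.1.symm).trans
          ((Quot.sound (GlueRel.edge (V.splitOut₂ s))).trans
            (congrArg (fun f => Quot.mk (GlueRel F G) (Sum.inr f)) hG.2.1))
      · exact (congrArg (fun f => Quot.mk (GlueRel F G) (Sum.inl f)) hF.2.2.symm).trans
          ((Quot.sound (GlueRel.edge (V.splitIn s))).trans
            (congrArg (fun f => Quot.mk (GlueRel F G) (Sum.inr f)) hG.2.2))
    · have hF := F.merge_match (.inr m)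
      have hG := G.split_match (.inl m)
      refine ⟨?_, ?_, ?_⟩
      · exact ((congrArg (fun f => Quot.mk (GlueRel F G) (Sum.inl f)) hF.1.symm).trans
          ((Quot.sound (GlueRel.edge (V.mergeIn₁ m))).trans
            (congrArg (fun f => Quot.mk (GlueRel F G) (Sum.inr f)) hG.1))).symm
      · exact ((congrArg (fun f => Quot.mk (GlueRel F G) (Sum.inl f)) hF.2.1.symm).trans
          ((Quot.sound (GlueRel.edge (V.mergeIn₂ m))).trans
            (congrArg (fun f => Quot.mk (GlueRel F G) (Sum.inr f)) hG.2.1))).symm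
      · exact ((congrArg (fun f => Quot.mk (GlueRel F G) (Sum.inl f)) hF.2.2.symm).trans
          ((Quot.sound (GlueRel.edge (V.mergeOut m))).trans
            (congrArg (fun f => Quot.mk (GlueRel F G) (Sum.inr f)) hG.2.2))).symm
  vertP_match := by
    rintro (v | v)
    · exact vertexMatch_map (f₁ := F.thin₁) (f₂ := F.thin₂) (f₃ := F.thick) (j := Sum.inl)
        (k := fun f => Quot.mk (GlueRel F G) (Sum.inl f)) (fun _ => rfl) (fun _ => rfl) (fun _ => rfl)
        (F.vertP_match v)
    · exact vertexMatch_map (f₁ := G.thin₁) (f₂ := G.thin₂) (f₃ := G.thick) (j := Sum.inr)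
        (k := fun f => Quot.mk (GlueRel F G) (Sum.inr f)) (fun _ => rfl) (fun _ => rfl) (fun _ => rfl)
        (G.vertP_match v)
  vertN_match := by
    rintro (v | v)
    · exact vertexMatch_map (f₁ := F.thin₁) (f₂ := F.thin₂) (f₃ := F.thick) (j := Sum.inl)
        (k := fun f => Quot.mk (GlueRel F G) (Sum.inl f)) (fun _ => rfl) (fun _ => rfl) (fun _ => rfl)
        (F.vertN_match v)
    · exact vertexMatch_map (f₁ := G.thin₁) (f₂ := G.thin₂) (f₃ := G.thick) (j := Sum.inr)
        (k := fun f => Quot.mk (GlueRel F G) (Sum.inr f)) (fun _ => rfl) (fun _ => rfl) (fun _ => rfl)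
        (G.vertN_match v)
  reg_match := by
    rintro (r | r)
    · exact congrArg (fun f => Quot.mk (GlueRel F G) (Sum.inl f)) (F.reg_match (.inl r))
    · exact congrArg (fun f => Quot.mk (GlueRel F G) (Sum.inr f)) (G.reg_match (.inr r))
  merge_match := by
    rintro (r | r)
    · have := F.merge_match (.inl r)
      exact ⟨congrArg (fun f => Quot.mk (GlueRel F G) (Sum.inl f)) this.1,
        congrArg (fun f => Quot.mk (GlueRel F G) (Sum.inl f)) this.2.1,
        congrArg (fun f => Quot.mk (GlueRel F G) (Sum.inl f)) this.2.2⟩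
    · have := G.merge_match (.inr r)
      exact ⟨congrArg (fun f => Quot.mk (GlueRel F G) (Sum.inr f)) this.1,
        congrArg (fun f => Quot.mk (GlueRel F G) (Sum.inr f)) this.2.1,
        congrArg (fun f => Quot.mk (GlueRel F G) (Sum.inr f)) this.2.2⟩
  split_match := by
    rintro (r | r)
    · have := F.split_match (.inl r)
      exact ⟨congrArg (fun f => Quot.mk (GlueRel F G) (Sum.inl f)) this.1,
        congrArg (fun f => Quot.mk (GlueRel F G) (Sum.inl f)) this.2.1,
        congrArg (fun f => Quot.mk (GlueRel F G) (Sum.inl f)) this.2.2⟩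
    · have := G.split_match (.inr r)
      exact ⟨congrArg (fun f => Quot.mk (GlueRel F G) (Sum.inr f)) this.1,
        congrArg (fun f => Quot.mk (GlueRel F G) (Sum.inr f)) this.2.1,
        congrArg (fun f => Quot.mk (GlueRel F G) (Sum.inr f)) this.2.2⟩

end TwoFoam

/-! ### The cobordism group of weighted oriented one-foams -/

namespace OneFoam

theorem cobordant_of_iso {U V : OneFoam} (i : U.Iso V) : Cobordant U V := by
  refine ⟨(TwoFoam.cyl U).transport
    ⟨(Equiv.refl _).sumCongr i.edge, (Equiv.refl _).sumCongr i.reg, (Equiv.refl _).sumCongr i.merge,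
      (Equiv.refl _).sumCongr i.split, ?_, ?_, ?_, ?_, ?_, ?_, ?_, ?_, ?_⟩⟩
  all_goals rintro (x | x)
  all_goals first | rfl | skip
  · exact i.weight x
  · exact congrArg Sum.inr (i.regIn x)
  · exact congrArg Sum.inr (i.regOut x)
  · exact congrArg Sum.inr (i.mergeIn₁ x)
  · exact congrArg Sum.inr (i.mergeIn₂ x)
  · exact congrArg Sum.inr (i.mergeOut x)
  · exact congrArg Sum.inr (i.splitIn x)
  · exact congrArg Sum.inr (i.splitOut₁ x)
  · exact congrArg Sum.inr (i.splitOut₂ x)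

theorem cobordant_symm {U V : OneFoam} : Cobordant U V → Cobordant V U := by
  rintro ⟨F⟩
  refine ⟨F.reverse.transport ⟨Equiv.sumComm _ _, Equiv.sumComm _ _, Equiv.sumComm _ _,
    Equiv.sumComm _ _, ?_, ?_, ?_, ?_, ?_, ?_, ?_, ?_, ?_⟩⟩
  all_goals rintro (x | x) <;> rfl

theorem cobordant_reverse {U V : OneFoam} :
    Cobordant U V → Cobordant U.reverse V.reverse := by
  rintro ⟨F⟩
  refine ⟨F.reverse.transport ⟨Equiv.refl _, Equiv.refl _, Equiv.refl _,
    Equiv.refl _, ?_, ?_, ?_, ?_, ?_, ?_, ?_, ?_, ?_⟩⟩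
  all_goals rintro (x | x) <;> rfl

theorem cobordant_union {U V U' V' : OneFoam} :
    Cobordant U V → Cobordant U' V' → Cobordant (U.union U') (V.union V') := by
  rintro ⟨F⟩ ⟨G⟩
  refine ⟨(F.union G).transport ⟨Equiv.sumSumSumComm _ _ _ _, Equiv.sumSumSumComm _ _ _ _,
    Equiv.sumSumSumComm _ _ _ _, Equiv.sumSumSumComm _ _ _ _, ?_, ?_, ?_, ?_, ?_, ?_, ?_, ?_, ?_⟩⟩
  all_goals rintro ((x | x) | (x | x)) <;> rfl

theorem cobordant_comm (U V : OneFoam) : Cobordant (U.union V) (V.union U) := by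
  refine cobordant_of_iso ⟨Equiv.sumComm _ _, Equiv.sumComm _ _, Equiv.sumComm _ _,
    Equiv.sumComm _ _, ?_, ?_, ?_, ?_, ?_, ?_, ?_, ?_, ?_⟩
  all_goals rintro (x | x) <;> rfl

theorem cobordant_assoc (U V W : OneFoam) :
    Cobordant ((U.union V).union W) (U.union (V.union W)) := by
  refine cobordant_of_iso ⟨Equiv.sumAssoc _ _ _, Equiv.sumAssoc _ _ _, Equiv.sumAssoc _ _ _,
    Equiv.sumAssoc _ _ _, ?_, ?_, ?_, ?_, ?_, ?_, ?_, ?_, ?_⟩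
  all_goals rintro ((x | x) | x) <;> rfl

/-- A one-foam does not change when the empty one-foam is added. -/
def unionEmpty (U : OneFoam) : (U.union empty).Iso U where
  edge := Equiv.sumEmpty _ Empty
  reg := Equiv.sumEmpty _ Empty
  merge := Equiv.sumEmpty _ Empty
  split := Equiv.sumEmpty _ Empty
  weight := by rintro (x | x); exacts [rfl, x.elim]
  regIn := by rintro (x | x); exacts [rfl, x.elim]
  regOut := by rintro (x | x); exacts [rfl, x.elim]
  mergeIn₁ := by rintro (x | x); exacts [rfl, x.elim]
  mergeIn₂ := by rintro (x | x); exacts [rfl, x.elim]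
  mergeOut := by rintro (x | x); exacts [rfl, x.elim]
  splitIn := by rintro (x | x); exacts [rfl, x.elim]
  splitOut₁ := by rintro (x | x); exacts [rfl, x.elim]
  splitOut₂ := by rintro (x | x); exacts [rfl, x.elim]

theorem cobordant_reverse_union (U : OneFoam) : Cobordant (U.reverse.union U) empty := by
  refine ⟨(TwoFoam.cyl U).reverse.transport ⟨(Equiv.sumEmpty _ Empty).symm,
    (Equiv.sumEmpty _ Empty).symm, (Equiv.sumEmpty _ Empty).symm, (Equiv.sumEmpty _ Empty).symm,
    ?_, ?_, ?_, ?_, ?_, ?_, ?_, ?_, ?_⟩⟩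
  all_goals intro x; rfl

/-- Cobordance is an equivalence relation. -/
instance cobSetoid : Setoid OneFoam where
  r := Cobordant
  iseqv :=
    { refl := fun U => ⟨TwoFoam.cyl U⟩
      symm := cobordant_symm
      trans := fun ⟨F⟩ ⟨G⟩ => ⟨F.glue G⟩ }

end OneFoam

/-- The cobordism group of weighted oriented one-foams. -/
def Cob : Type 1 := Quotient OneFoam.cobSetoid

namespace Cob

/-- The cobordism class of a one-foam. -/
def mk (U : OneFoam) : Cob := Quotient.mk _ U

/-- The zero element is the class of the empty one-foam. -/
instance : Zero Cob := ⟨mk OneFoam.empty⟩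

/-- Addition is disjoint union. -/
instance : Add Cob :=
  ⟨Quotient.map₂ OneFoam.union fun _ _ h _ _ h' => OneFoam.cobordant_union h h'⟩

/-- The inverse is orientation reversal. -/
instance : Neg Cob :=
  ⟨Quotient.map OneFoam.reverse fun _ _ h => OneFoam.cobordant_reverse h⟩

instance : AddCommGroup Cob where
  add_assoc := by
    rintro ⟨U⟩ ⟨V⟩ ⟨W⟩
    exact Quotient.sound (OneFoam.cobordant_assoc U V W)
  add_comm := by
    rintro ⟨U⟩ ⟨V⟩
    exact Quotient.sound (OneFoam.cobordant_comm U V)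
  add_zero := by
    rintro ⟨U⟩
    exact Quotient.sound (OneFoam.cobordant_of_iso U.unionEmpty)
  zero_add := by
    rintro ⟨U⟩
    exact (Quotient.sound (OneFoam.cobordant_comm _ U)).trans
      (Quotient.sound (OneFoam.cobordant_of_iso U.unionEmpty))
  neg_add_cancel := by
    rintro ⟨U⟩
    exact Quotient.sound (OneFoam.cobordant_reverse_union U)
  nsmul := nsmulRec
  zsmul := zsmulRec

/-- A one-foam represents zero if and only if it bounds a two-foam. -/
theorem mk_eq_zero_iff (U : OneFoam) : mk U = 0 ↔ Nonempty (TwoFoam U) := by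
  have key : ∀ V : OneFoam, Nonempty (TwoFoam V.reverse) → mk V = 0 := fun V ⟨F⟩ =>
    Quotient.sound ⟨F.transport ⟨(Equiv.sumEmpty _ Empty).symm, (Equiv.sumEmpty _ Empty).symm,
      (Equiv.sumEmpty _ Empty).symm, (Equiv.sumEmpty _ Empty).symm, fun _ => rfl, fun _ => rfl,
      fun _ => rfl, fun _ => rfl, fun _ => rfl, fun _ => rfl, fun _ => rfl, fun _ => rfl,
      fun _ => rfl⟩⟩
  refine ⟨fun h => ?_, fun ⟨F⟩ => key U ⟨F.reverse⟩⟩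
  obtain ⟨F⟩ : Cobordant U OneFoam.empty := Quotient.exact h
  exact ⟨(F.transport (OneFoam.unionEmpty U.reverse)).reverse⟩

end Cob

/-! ### Interval exchange transformations -/

/-- The data `(λ, σ)` of an interval exchange transformation of `[0,1)`: positive lengths of `r`
intervals with sum `1` (hence `r ≥ 1`), and a permutation. -/
structure IETData where
  r : ℕ
  len : Fin r → ℝ
  len_pos : ∀ i, 0 < len i
  len_sum : ∑ i, len i = 1
  perm : Equiv.Perm (Fin r)

namespace IETData

variable (D : IETData)

/-- The left end of the `i`-th interval when the intervals are put in the order that `τ`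
prescribes, that is, when the `j`-th interval is `τ j`-th in the order. -/
noncomputable def left (τ : Equiv.Perm (Fin D.r)) (i : Fin D.r) : ℝ :=
  ∑ j with τ j < τ i, D.len j

theorem left_nonneg (τ : Equiv.Perm (Fin D.r)) (i : Fin D.r) : 0 ≤ D.left τ i :=
  Finset.sum_nonneg fun j _ => (D.len_pos j).le

theorem left_add_len (τ : Equiv.Perm (Fin D.r)) (i : Fin D.r) :
    D.left τ i + D.len i = ∑ j with τ j ≤ τ i, D.len j := by
  classical
  have : (Finset.univ.filter fun j => τ j ≤ τ i) =
      insert i (Finset.univ.filter fun j => τ j < τ i) := by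
    ext j
    simp only [Finset.mem_filter, Finset.mem_univ, true_and, Finset.mem_insert, le_iff_lt_or_eq,
      τ.injective.eq_iff]
    tauto
  rw [this, Finset.sum_insert (by simp), left, add_comm]

theorem left_add_len_le_one (τ : Equiv.Perm (Fin D.r)) (i : Fin D.r) :
    D.left τ i + D.len i ≤ 1 := by
  rw [left_add_len, ← D.len_sum]
  exact Finset.sum_le_sum_of_subset_of_nonneg (Finset.subset_univ _)
    fun j _ _ => (D.len_pos j).le

theorem left_add_len_le_left (τ : Equiv.Perm (Fin D.r)) {i j : Fin D.r} (h : τ i < τ j) :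
    D.left τ i + D.len i ≤ D.left τ j := by
  rw [left_add_len]
  refine Finset.sum_le_sum_of_subset_of_nonneg (fun k hk => ?_) fun j _ _ => (D.len_pos j).le
  simp only [Finset.mem_filter, Finset.mem_univ, true_and] at hk ⊢
  exact hk.trans_lt h

/-- Put the intervals `[0, λ_i)` side by side in the order that `τ` prescribes. -/
noncomputable def place (τ : Equiv.Perm (Fin D.r)) (p : Σ i : Fin D.r, Set.Ico (0 : ℝ) (D.len i)) :
    Set.Ico (0 : ℝ) 1 :=
  ⟨D.left τ p.1 + p.2, add_nonneg (D.left_nonneg τ p.1) p.2.2.1,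
    (add_lt_add_right p.2.2.2 _).trans_le (D.left_add_len_le_one τ p.1)⟩

theorem place_bijective (τ : Equiv.Perm (Fin D.r)) : Function.Bijective (D.place τ) := by
  constructor
  · rintro ⟨i, x⟩ ⟨j, y⟩ h
    have h' : D.left τ i + x = D.left τ j + y := congrArg Subtype.val h
    rcases lt_trichotomy (τ i) (τ j) with hij | hij | hij
    · have := D.left_add_len_le_left τ hij
      have := x.2.2
      have := y.2.1
      linarith
    · obtain rfl := τ.injective hij
      have : x = y := Subtype.ext (by linarith)
      rw [this]
    · have := D.left_add_len_le_left τ hij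
      have := y.2.2
      have := x.2.1
      linarith
  · rintro ⟨y, hy0, hy1⟩
    have hr : 0 < D.r := by
      rcases Nat.eq_zero_or_pos D.r with h | h
      · have := D.len_sum
        have : IsEmpty (Fin D.r) := by rw [h]; infer_instance
        simp_all
      · exact h
    have hne : (Finset.univ.filter fun i => D.left τ i ≤ y).Nonempty := by
      refine ⟨τ.symm ⟨0, hr⟩, ?_⟩
      simp only [Finset.mem_filter, Finset.mem_univ, true_and]
      refine le_trans (le_of_eq ?_) hy0
      refine Finset.sum_eq_zero fun j hj => ?_
      simp [Fin.lt_def] at hj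
    obtain ⟨i, hi, hmax⟩ := Finset.exists_max_image _ τ hne
    simp only [Finset.mem_filter, Finset.mem_univ, true_and] at hi hmax
    have hlt : y < D.left τ i + D.len i := by
      by_contra! hge
      have hlast : ∀ j, τ j ≤ τ i := by
        by_contra! hex
        obtain ⟨j, hj⟩ := hex
        have hk : (τ i : ℕ) + 1 < D.r := lt_of_le_of_lt (Fin.lt_def.1 hj) (τ j).2
        have hle : D.left τ (τ.symm ⟨τ i + 1, hk⟩) ≤ y := by
          refine le_trans (le_of_eq ?_) hge
          rw [left_add_len, left]
          refine Finset.sum_congr ?_ fun _ _ => rfl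
          ext k
          simp only [Finset.mem_filter, Finset.mem_univ, true_and, Equiv.apply_symm_apply,
            Fin.lt_def, Fin.le_def]
          omega
        have := hmax _ hle
        simp [Fin.le_def] at this
      rw [left_add_len, Finset.filter_true_of_mem fun j _ => hlast j, D.len_sum] at hge
      linarith
    exact ⟨⟨i, ⟨y - D.left τ i, by linarith, by linarith⟩⟩, Subtype.ext (by simp [place])⟩

/-- The interval exchange transformation `T_{λ,σ}`: cut `[0,1)` into consecutive intervals of
lengths `λ_1, …, λ_r`, and put the `i`-th of them into the `σ(i)`-th place. -/
noncomputable def map : Equiv.Perm (Set.Ico (0 : ℝ) 1) :=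
  (Equiv.ofBijective _ (D.place_bijective 1)).symm.trans
    (Equiv.ofBijective _ (D.place_bijective D.perm))

theorem map_place (p : Σ i : Fin D.r, Set.Ico (0 : ℝ) (D.len i)) :
    D.map (D.place 1 p) = D.place D.perm p := by
  have : (Equiv.ofBijective _ (D.place_bijective 1)).symm (D.place 1 p) = p :=
    (Equiv.ofBijective _ (D.place_bijective 1)).symm_apply_apply p
  rw [map, Equiv.trans_apply, this]
  rfl

/-- A helper notion: a self-map of `[0,1)` which is a translation on every interval that contains
none of finitely many break points, except possibly as its left end. -/
def IsPiecewise (f : Set.Ico (0 : ℝ) 1 → Set.Ico (0 : ℝ) 1) : Prop :=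
  ∃ B : Finset ℝ, ∀ x y : Set.Ico (0 : ℝ) 1, x ≤ y → (∀ b ∈ B, ¬ ((x : ℝ) < b ∧ b ≤ y)) →
    (f y : ℝ) - f x = y - x

theorem isPiecewise_comp {f g : Set.Ico (0 : ℝ) 1 → Set.Ico (0 : ℝ) 1} (hf : IsPiecewise f)
    (hg : IsPiecewise g) (hinj : Function.Injective f) : IsPiecewise (g ∘ f) := by
  classical
  obtain ⟨B, hB⟩ := hf
  obtain ⟨C, hC⟩ := hg
  let C' : Set (Set.Ico (0 : ℝ) 1) := {z | (f z : ℝ) ∈ C}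
  have hC' : C'.Finite :=
    Set.Finite.preimage (f := fun z => (f z : ℝ))
      (Subtype.val_injective.comp hinj).injOn C.finite_toSet
  refine ⟨B ∪ hC'.toFinset.image Subtype.val, fun x y hxy h => ?_⟩
  have h1 := hB x y hxy fun b hb => h b (Finset.mem_union_left _ hb)
  have hxy' : (x : ℝ) ≤ y := hxy
  have h2 := hC (f x) (f y) (by
    change (f x : ℝ) ≤ f y
    linarith) fun c hc hcxy => by
      let z : Set.Ico (0 : ℝ) 1 := ⟨x + (c - f x), by linarith [x.2.1], by linarith [y.2.2]⟩
      have hz := hB x z (by change (x : ℝ) ≤ x + (c - f x); linarith) fun b hb hbz =>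
        h b (Finset.mem_union_left _ hb) ⟨hbz.1, hbz.2.trans (by
          change (x : ℝ) + (c - f x) ≤ y; linarith)⟩
      have hzc : (f z : ℝ) = c := by
        have : (z : ℝ) = x + (c - f x) := rfl
        linarith
      refine h z (Finset.mem_union_right _ (Finset.mem_image_of_mem _ ?_)) ⟨?_, ?_⟩
      · rw [Set.Finite.mem_toFinset]
        change (f z : ℝ) ∈ C
        rwa [hzc]
      · change (x : ℝ) < x + (c - f x); linarith
      · change (x : ℝ) + (c - f x) ≤ y; linarith
  simp only [Function.comp]
  linarith

theorem isPiecewise_of_place {τ τ' : Equiv.Perm (Fin D.r)}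
    {f : Set.Ico (0 : ℝ) 1 → Set.Ico (0 : ℝ) 1} (hf : ∀ p, f (D.place τ p) = D.place τ' p) :
    IsPiecewise f := by
  classical
  refine ⟨Finset.univ.image (D.left τ), fun x y hxy h => ?_⟩
  obtain ⟨⟨i, a⟩, rfl⟩ := (D.place_bijective τ).2 x
  obtain ⟨⟨j, b⟩, rfl⟩ := (D.place_bijective τ).2 y
  have hxy' : D.left τ i + a ≤ D.left τ j + b := hxy
  have ha := a.2
  have hb := b.2
  have hj := h (D.left τ j) (Finset.mem_image_of_mem _ (Finset.mem_univ _))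
  simp only [place, not_and, not_le] at hj
  have hij : i = j := by
    rcases lt_trichotomy (τ i) (τ j) with hij | hij | hij
    · have := D.left_add_len_le_left τ hij
      have := hj (by linarith [ha.2])
      linarith [hb.1]
    · exact τ.injective hij
    · have := D.left_add_len_le_left τ hij
      linarith [ha.1, hb.2]
  subst hij
  rw [hf, hf]
  simp [place]

theorem sum_len_le {ι : Type} [DecidableEq ι] (len q : ι → ℝ) (hlen : ∀ i, 0 < len i)
    (hdis : ∀ i j, i ≠ j → q i + len i ≤ q j ∨ q j + len j ≤ q i) (a : ℝ) (S : Finset ι) :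
    ∀ b : ℝ, a ≤ b → (∀ i ∈ S, a ≤ q i ∧ q i + len i ≤ b) → ∑ i ∈ S, len i ≤ b - a := by
  induction S using Finset.induction_on_max_value q with
  | empty => intro b hab _; simpa using hab
  | insert m S hm hmax ih =>
    intro b _ h
    rw [Finset.sum_insert hm]
    have h1 := h m (Finset.mem_insert_self _ _)
    have h2 := ih (q m) h1.1 fun i hi => ⟨(h i (Finset.mem_insert_of_mem hi)).1, by
      have hne : i ≠ m := by rintro rfl; exact hm hi
      rcases hdis i m hne with h3 | h3
      · exact h3
      · have := hmax i hi
        linarith [hlen m]⟩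
    linarith

theorem eq_sum_len {r : ℕ} (len q : Fin r → ℝ) (hlen : ∀ i, 0 < len i) (hsum : ∑ i, len i = 1)
    (hdis : ∀ i j, i ≠ j → q i + len i ≤ q j ∨ q j + len j ≤ q i) (h0 : ∀ i, 0 ≤ q i)
    (h1 : ∀ i, q i + len i ≤ 1) (i : Fin r) : ∑ j with q j < q i, len j = q i := by
  have hinj : ∀ j k, q j = q k → j = k := by
    intro j k h
    by_contra hne
    have := hlen j
    have := hlen k
    rcases hdis j k hne with h | h <;> linarith
  have hle := sum_len_le len q hlen hdis 0 (Finset.univ.filter fun j => q j < q i) (q i) (h0 i)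
    fun j hj => ⟨h0 j, by
      have hlt : q j < q i := by simpa using hj
      rcases hdis j i (by rintro rfl; exact lt_irrefl _ hlt) with h | h
      · exact h
      · linarith [hlen i]⟩
  have hge := sum_len_le len q hlen hdis (q i) (Finset.univ.filter fun j => ¬ q j < q i) 1
    (by linarith [h1 i, hlen i]) fun j hj => ⟨by simpa using hj, h1 j⟩
  have := Finset.sum_filter_add_sum_filter_not Finset.univ (fun j => q j < q i) len
  linarith

theorem exists_map_eq (f : Equiv.Perm (Set.Ico (0 : ℝ) 1)) (hf : IsPiecewise f) :
    ∃ D : IETData, D.map = f := by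
  classical
  obtain ⟨B, hB⟩ := hf
  let B' : Finset ℝ := insert 0 (B.filter fun b => 0 < b ∧ b < 1)
  have hB'0 : ∀ b ∈ B', 0 ≤ b ∧ b < 1 := by
    intro b hb
    rcases Finset.mem_insert.1 hb with rfl | hb
    · norm_num
    · have := (Finset.mem_filter.1 hb).2
      exact ⟨this.1.le, this.2⟩
  obtain ⟨r, hr⟩ : ∃ r, B'.card = r := ⟨_, rfl⟩
  let p := B'.orderEmbOfFin hr
  have hp : ∀ i, 0 ≤ p i ∧ p i < 1 := fun i => hB'0 _ (B'.orderEmbOfFin_mem hr i)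
  have hr0 : 0 < r := by
    rw [← hr]
    exact Finset.card_pos.2 ⟨0, Finset.mem_insert_self _ _⟩
  let P : ℕ → ℝ := fun k => if h : k < r then p ⟨k, h⟩ else 1
  have hP : ∀ i : Fin r, P i = p i := fun i => by simp [P]
  have hPr : ∀ k, r ≤ k → P k = 1 := fun k hk => by simp [P, hk]
  have hPmono : ∀ (i : Fin r) (k : ℕ), (i : ℕ) < k → p i < P k := by
    intro i k hk
    by_cases h : k < r
    · have : p i < p ⟨k, h⟩ := p.lt_iff_lt.2 hk
      simpa [P, h] using this
    · rw [hPr k (by omega)]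
      exact (hp i).2
  have hPle : ∀ (i : Fin r) (k : ℕ), k ≤ (i : ℕ) → P k ≤ p i := by
    intro i k hk
    have h : k < r := lt_of_le_of_lt hk i.2
    have : p ⟨k, h⟩ ≤ p i := p.le_iff_le.2 hk
    simpa [P, h] using this
  have hP0 : P 0 = 0 := by
    refine le_antisymm ?_ ?_
    · have : (0 : ℝ) ∈ Set.range p := by
        rw [Finset.range_orderEmbOfFin]
        exact Finset.mem_insert_self _ _
      obtain ⟨i, hi⟩ := this
      exact (hPle i 0 (Nat.zero_le _)).trans_eq hi
    · have := (hp ⟨0, hr0⟩).1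
      rwa [← hP] at this
  let len : Fin r → ℝ := fun i => P (i + 1) - p i
  have hlen : ∀ i, 0 < len i := fun i => sub_pos.2 (hPmono i _ (Nat.lt_succ_self _))
  have hsum : ∑ i, len i = 1 := by
    have h1 : ∑ i, len i = ∑ i : Fin r, (fun k => P (k + 1) - P k) i :=
      Finset.sum_congr rfl fun i _ => by simp only [len, hP]
    rw [h1, Fin.sum_univ_eq_sum_range (fun k => P (k + 1) - P k), Finset.sum_range_sub, hP0,
      hPr r le_rfl, sub_zero]
  have hple1 : ∀ i, p i + len i ≤ 1 := by
    intro i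
    simp only [len, add_sub_cancel]
    by_cases h : (i : ℕ) + 1 < r
    · have := (hp ⟨i + 1, h⟩).2.le
      simpa [P, h] using this
    · rw [hPr _ (by omega)]
  have hpdis : ∀ i j, i < j → p i + len i ≤ p j := by
    intro i j hij
    simp only [len, add_sub_cancel]
    exact hPle j _ hij
  -- on each interval the map is a translation
  let P' : Fin r → Set.Ico (0 : ℝ) 1 := fun i => ⟨p i, (hp i).1, (hp i).2⟩
  let q : Fin r → ℝ := fun i => f (P' i)
  have htr : ∀ (i : Fin r) (x : Set.Ico (0 : ℝ) 1), p i ≤ x → (x : ℝ) < p i + len i →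
      (f x : ℝ) = q i + (x - p i) := by
    intro i x hx hx'
    have := hB (P' i) x hx fun b hb hbx => by
      have hbx1 : p i < b := hbx.1
      have hb' : b ∈ B' := Finset.mem_insert_of_mem (Finset.mem_filter.2
        ⟨hb, lt_of_le_of_lt (hp i).1 hbx1, lt_of_le_of_lt hbx.2 x.2.2⟩)
      have : b ∈ Set.range p := by
        rw [Finset.range_orderEmbOfFin]
        exact hb'
      obtain ⟨j, rfl⟩ := this
      have := hpdis i j (p.lt_iff_lt.1 hbx1)
      linarith [hbx.2]
    have h2 : ((P' i : Set.Ico (0 : ℝ) 1) : ℝ) = p i := rfl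
    change (f x : ℝ) = f (P' i) + (x - p i)
    linarith
  have hq0 : ∀ i, 0 ≤ q i := fun i => (f (P' i)).2.1
  have hq1 : ∀ i, q i + len i ≤ 1 := by
    intro i
    by_contra! h
    have hq : q i < 1 := (f (P' i)).2.2
    let x : Set.Ico (0 : ℝ) 1 := ⟨p i + (1 - q i), by linarith [(hp i).1], by linarith [hple1 i]⟩
    have h1 := htr i x (by change p i ≤ p i + (1 - q i); linarith)
      (by change p i + (1 - q i) < _; linarith)
    have h2 : (x : ℝ) = p i + (1 - q i) := rfl
    linarith [(f x).2.2]
  have hqdis' : ∀ i j, i ≠ j → q i ≤ q j → q i + len i ≤ q j := by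
    intro i j hij hq
    by_contra! h
    let x : Set.Ico (0 : ℝ) 1 := ⟨p i + (q j - q i), by linarith [(hp i).1], by
      linarith [hple1 i]⟩
    have hx : (x : ℝ) = p i + (q j - q i) := rfl
    have h1 := htr i x (by linarith) (by linarith)
    have h2 : f x = f (P' j) := Subtype.ext (by
      change (f x : ℝ) = q j
      linarith)
    have h3 : (x : ℝ) = p j := congrArg Subtype.val (f.injective h2)
    rcases lt_or_gt_of_ne hij with hij | hij
    · have := hpdis i j hij
      linarith
    · have := hpdis j i hij
      have := hlen j
      linarith
  have hqdis : ∀ i j, i ≠ j → q i + len i ≤ q j ∨ q j + len j ≤ q i := by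
    intro i j hij
    rcases le_total (q i) (q j) with h | h
    · exact Or.inl (hqdis' i j hij h)
    · exact Or.inr (hqdis' j i hij.symm h)
  have hqinj : Function.Injective q := fun i j h => by
    have h1 : P' i = P' j := f.injective (Subtype.ext h)
    have h2 : ((P' i : Set.Ico (0 : ℝ) 1) : ℝ) = P' j := by rw [h1]
    exact p.injective h2
  let σ : Equiv.Perm (Fin r) := (Tuple.sort q).symm
  have hmono : StrictMono (q ∘ Tuple.sort q) :=
    (Tuple.monotone_sort q).strictMono_of_injective (hqinj.comp (Tuple.sort q).injective)
  have hσ : ∀ i j, σ i < σ j ↔ q i < q j := by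
    intro i j
    rw [← hmono.lt_iff_lt]
    simp [σ]
  refine ⟨⟨r, len, hlen, hsum, σ⟩, ?_⟩
  set D : IETData := ⟨r, len, hlen, hsum, σ⟩ with hD
  have hleft1 : ∀ i : Fin r, D.left 1 i = p i := by
    intro i
    rw [← eq_sum_len len p hlen hsum (fun i j hij => (lt_or_gt_of_ne hij).imp (hpdis i j)
      (hpdis j i)) (fun i => (hp i).1) hple1 i]
    refine Finset.sum_congr (Finset.filter_congr fun j _ => ?_) fun _ _ => rfl
    exact p.lt_iff_lt.symm
  have hleftσ : ∀ i : Fin r, D.left σ i = q i := by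
    intro i
    rw [← eq_sum_len len q hlen hsum hqdis hq0 hq1 i]
    exact Finset.sum_congr (Finset.filter_congr fun j _ => hσ j i) fun _ _ => rfl
  ext y
  obtain ⟨⟨i, x⟩, rfl⟩ := (D.place_bijective 1).2 y
  have hv : ((D.place 1 ⟨i, x⟩ : Set.Ico (0 : ℝ) 1) : ℝ) = p i + x := by
    rw [← hleft1 i]
    rfl
  have hx0 : (0 : ℝ) ≤ x := x.2.1
  have hx1 : (x : ℝ) < len i := x.2.2
  rw [map_place, htr i (D.place 1 ⟨i, x⟩) (by linarith) (by linarith), hv, ← hleftσ i]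
  change D.left σ i + x = _
  ring

end IETData

/-- The group of interval exchange transformations of `[0,1)`: the bijections `T_{λ,σ}` with the
composition of maps, `(f * g) x = f (g x)`. -/
noncomputable def AutIET : Subgroup (Equiv.Perm (Set.Ico (0 : ℝ) 1)) where
  carrier := Set.range IETData.map
  mul_mem' := by
    rintro _ _ ⟨D, rfl⟩ ⟨E, rfl⟩
    have hE := E.isPiecewise_of_place (τ := 1) (τ' := E.perm) (f := E.map) E.map_place
    have hD := D.isPiecewise_of_place (τ := 1) (τ' := D.perm) (f := D.map) D.map_place
    exact IETData.exists_map_eq (D.map * E.map) (IETData.isPiecewise_comp (f := E.map)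
      (g := D.map) hE hD E.map.injective)
  one_mem' := IETData.exists_map_eq 1 ⟨∅, fun _ _ _ _ => rfl⟩
  inv_mem' := by
    rintro _ ⟨D, rfl⟩
    refine IETData.exists_map_eq D.map⁻¹
      (D.isPiecewise_of_place (τ := D.perm) (τ' := 1) (f := ⇑D.map⁻¹) fun p => ?_)
    rw [← D.map_place]
    exact D.map.symm_apply_apply _

/-- The interval exchange transformation `T_{λ,σ}` as an element of the group. -/
noncomputable def IETData.toAut (D : IETData) : AutIET := ⟨D.map, D, rfl⟩

/-! ### The closed one-foam of an interval exchange transformation -/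

/-- Plane binary trees with `n` leaves, numbered from left to right: the ways to split a line into
`n` lines (or to merge `n` lines into one) in a sequence of binary splits (merges). -/
inductive PlaneTree : ℕ → Type
  | leaf : PlaneTree 1
  | node {m n : ℕ} (s : PlaneTree m) (t : PlaneTree n) : PlaneTree (m + n)

namespace PlaneTree

/-- The inner vertices of a tree: none for `leaf`; for `node s t` they are the root `none`, the
inner vertices `some (inl p)` of `s` and the inner vertices `some (inr p)` of `t`. -/
@[reducible] def Inner {n : ℕ} (t : PlaneTree n) : Type :=
  PlaneTree.rec Empty (fun _ _ A B => Option (A ⊕ B)) t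

/-- The root of a tree, which is a leaf or an inner vertex. -/
def root : {n : ℕ} → (t : PlaneTree n) → Fin n ⊕ t.Inner
  | _, leaf => .inl 0
  | _, node _ _ => .inr none

/-- The leaves and inner vertices of the left subtree `s` of `node s t`. -/
def inLeft {m n : ℕ} (s : PlaneTree m) (t : PlaneTree n) :
    Fin m ⊕ s.Inner → Fin (m + n) ⊕ (node s t).Inner :=
  Sum.map (Fin.castAdd n) (fun p => some (.inl p))

/-- The leaves and inner vertices of the right subtree `t` of `node s t`. -/
def inRight {m n : ℕ} (s : PlaneTree m) (t : PlaneTree n) :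
    Fin n ⊕ t.Inner → Fin (m + n) ⊕ (node s t).Inner :=
  Sum.map (Fin.natAdd m) (fun p => some (.inr p))

/-- The left child of an inner vertex. -/
def child₁ : {n : ℕ} → (t : PlaneTree n) → t.Inner → Fin n ⊕ t.Inner
  | _, leaf, p => p.elim
  | _, node s t, none => inLeft s t s.root
  | _, node s t, some (.inl p) => inLeft s t (s.child₁ p)
  | _, node s t, some (.inr p) => inRight s t (t.child₁ p)

/-- The right child of an inner vertex. -/
def child₂ : {n : ℕ} → (t : PlaneTree n) → t.Inner → Fin n ⊕ t.Inner
  | _, leaf, p => p.elim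
  | _, node s t, none => inRight s t t.root
  | _, node s t, some (.inl p) => inLeft s t (s.child₂ p)
  | _, node s t, some (.inr p) => inRight s t (t.child₂ p)

/-- The total weight of the leaves below an inner vertex. -/
noncomputable def innerWeight : {n : ℕ} → (t : PlaneTree n) → (Fin n → ℝ) → t.Inner → ℝ
  | _, leaf, _, p => p.elim
  | _, node _ _, w, none => ∑ i, w i
  | _, node (n := n) s _, w, some (.inl p) => s.innerWeight (fun i => w (Fin.castAdd n i)) p
  | _, node (m := m) _ t, w, some (.inr p) => t.innerWeight (fun i => w (Fin.natAdd m i)) p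

/-- The total weight of the leaves below a leaf or an inner vertex. -/
noncomputable def weight {n : ℕ} (t : PlaneTree n) (w : Fin n → ℝ) : Fin n ⊕ t.Inner → ℝ :=
  Sum.elim w (t.innerWeight w)

instance finite_inner : {n : ℕ} → (t : PlaneTree n) → Finite t.Inner
  | _, leaf => inferInstanceAs (Finite Empty)
  | _, node s t =>
    have := s.finite_inner
    have := t.finite_inner
    inferInstanceAs (Finite (Option (s.Inner ⊕ t.Inner)))

theorem weight_inLeft {m n : ℕ} (s : PlaneTree m) (t : PlaneTree n) (w : Fin (m + n) → ℝ) (x) :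
    (node s t).weight w (inLeft s t x) = s.weight (fun i => w (Fin.castAdd n i)) x := by
  rcases x with x | x <;> rfl

theorem weight_inRight {m n : ℕ} (s : PlaneTree m) (t : PlaneTree n) (w : Fin (m + n) → ℝ) (x) :
    (node s t).weight w (inRight s t x) = t.weight (fun i => w (Fin.natAdd m i)) x := by
  rcases x with x | x <;> rfl

theorem weight_root {n : ℕ} (t : PlaneTree n) (w : Fin n → ℝ) : t.weight w t.root = ∑ i, w i := by
  cases t with
  | leaf => simp [weight, root]
  | node s t => rfl

theorem weight_child {n : ℕ} (t : PlaneTree n) (w : Fin n → ℝ) (p : t.Inner) :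
    t.weight w (t.child₁ p) + t.weight w (t.child₂ p) = t.weight w (.inr p) := by
  induction t with
  | leaf => exact p.elim
  | node s t hs ht =>
    rcases p with _ | p | p
    · change (node s t).weight w (inLeft s t s.root) + (node s t).weight w (inRight s t t.root) =
        ∑ i, w i
      rw [weight_inLeft, weight_inRight, weight_root, weight_root, Fin.sum_univ_add]
    · change (node s t).weight w (inLeft s t (s.child₁ p)) +
        (node s t).weight w (inLeft s t (s.child₂ p)) = _
      rw [weight_inLeft, weight_inLeft, hs]
      rfl
    · change (node s t).weight w (inRight s t (t.child₁ p)) +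
        (node s t).weight w (inRight s t (t.child₂ p)) = _
      rw [weight_inRight, weight_inRight, ht]
      rfl

theorem nonempty {n : ℕ} (t : PlaneTree n) : Nonempty (Fin n) := by
  induction t with
  | leaf => exact ⟨0⟩
  | node s t hs ht => exact hs.map (Fin.castAdd _)

theorem weight_pos {n : ℕ} (t : PlaneTree n) (w : Fin n → ℝ) (hw : ∀ i, 0 < w i)
    (x : Fin n ⊕ t.Inner) : 0 < t.weight w x := by
  rcases x with i | p
  · exact hw i
  · induction t with
    | leaf => exact p.elim
    | @node m n s t hs ht =>
      rcases p with _ | p | p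
      · rw [← weight_child]
        change 0 < (node s t).weight w (inLeft s t s.root) +
          (node s t).weight w (inRight s t t.root)
        rw [weight_inLeft, weight_inRight, weight_root, weight_root]
        have := s.nonempty
        have := t.nonempty
        exact add_pos (Finset.sum_pos (fun _ _ => hw _) Finset.univ_nonempty)
          (Finset.sum_pos (fun _ _ => hw _) Finset.univ_nonempty)
      · exact hs _ (fun i => hw _) p
      · exact ht _ (fun i => hw _) p

theorem inLeft_injective {m n : ℕ} (s : PlaneTree m) (t : PlaneTree n) :
    Function.Injective (inLeft s t) :=
  Sum.map_injective.2 ⟨Fin.castAdd_injective m n,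
    fun _ _ h => Sum.inl_injective (Option.some_injective _ h)⟩

theorem inRight_injective {m n : ℕ} (s : PlaneTree m) (t : PlaneTree n) :
    Function.Injective (inRight s t) :=
  Sum.map_injective.2 ⟨Fin.natAdd_injective n m,
    fun _ _ h => Sum.inr_injective (Option.some_injective _ h)⟩

theorem inLeft_ne_inRight {m n : ℕ} (s : PlaneTree m) (t : PlaneTree n) (x y) :
    inLeft s t x ≠ inRight s t y := by
  rcases x with x | x <;> rcases y with y | y <;> intro h
  · have h' : Fin.castAdd n x = Fin.natAdd m y := Sum.inl_injective h
    have := congrArg Fin.val h'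
    simp only [Fin.val_castAdd, Fin.val_natAdd] at this
    omega
  · cases h
  · cases h
  · have h' := Option.some_injective _ (Sum.inr_injective h)
    cases h'

theorem inLeft_ne_root {m n : ℕ} (s : PlaneTree m) (t : PlaneTree n) (x) :
    inLeft s t x ≠ (node s t).root := by
  rcases x with x | x <;> intro h
  · cases h
  · have h' := Sum.inr_injective h
    cases h'

theorem inRight_ne_root {m n : ℕ} (s : PlaneTree m) (t : PlaneTree n) (x) :
    inRight s t x ≠ (node s t).root := by
  rcases x with x | x <;> intro h
  · cases h
  · have h' := Sum.inr_injective h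
    cases h'

/-- The root, the left children and the right children. -/
def rootOrChild {n : ℕ} (t : PlaneTree n) : Unit ⊕ (t.Inner ⊕ t.Inner) → Fin n ⊕ t.Inner :=
  Sum.elim (fun _ => t.root) (Sum.elim t.child₁ t.child₂)

/-- Every leaf and every inner vertex is either the root or a child of an inner vertex, in exactly
one way. -/
theorem rootOrChild_bijective {n : ℕ} (t : PlaneTree n) : Function.Bijective t.rootOrChild := by
  induction t with
  | leaf =>
    constructor
    · rintro (_ | x | x) (_ | y | y) _
      all_goals first | rfl | exact x.elim | exact y.elim
    · rintro (x | x)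
      · exact ⟨.inl (), congrArg Sum.inl (Subsingleton.elim _ _)⟩
      · exact x.elim
  | @node m n s t hs ht =>
    -- the same map, grouped by the subtrees
    let k : Unit ⊕ (Option (s.Inner ⊕ t.Inner) ⊕ Option (s.Inner ⊕ t.Inner)) →
        Unit ⊕ ((Unit ⊕ (s.Inner ⊕ s.Inner)) ⊕ (Unit ⊕ (t.Inner ⊕ t.Inner))) := fun x =>
      match x with
      | .inl _ => .inl ()
      | .inr (.inl none) => .inr (.inl (.inl ()))
      | .inr (.inr none) => .inr (.inr (.inl ()))
      | .inr (.inl (some (.inl p))) => .inr (.inl (.inr (.inl p)))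
      | .inr (.inr (some (.inl p))) => .inr (.inl (.inr (.inr p)))
      | .inr (.inl (some (.inr p))) => .inr (.inr (.inr (.inl p)))
      | .inr (.inr (some (.inr p))) => .inr (.inr (.inr (.inr p)))
    have hk : Function.Bijective k := by
      constructor
      · rintro (_ | (_ | p | p) | (_ | p | p)) (_ | (_ | p' | p') | (_ | p' | p')) h <;>
          simp_all [k]
      · rintro (_ | (_ | p | p) | (_ | p | p))
        exacts [⟨.inl (), rfl⟩, ⟨.inr (.inl none), rfl⟩, ⟨.inr (.inl (some (.inl p))), rfl⟩,
          ⟨.inr (.inr (some (.inl p))), rfl⟩, ⟨.inr (.inr none), rfl⟩,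
          ⟨.inr (.inl (some (.inr p))), rfl⟩, ⟨.inr (.inr (some (.inr p))), rfl⟩]
    let g : Unit ⊕ ((Fin m ⊕ s.Inner) ⊕ (Fin n ⊕ t.Inner)) → Fin (m + n) ⊕ (node s t).Inner :=
      Sum.elim (fun _ => (node s t).root) (Sum.elim (inLeft s t) (inRight s t))
    have hg : Function.Bijective g := by
      constructor
      · rintro (_ | x | x) (_ | y | y) h
        · rfl
        · exact absurd h.symm (inLeft_ne_root s t y)
        · exact absurd h.symm (inRight_ne_root s t y)
        · exact absurd h (inLeft_ne_root s t x)
        · exact congrArg (fun z => Sum.inr (Sum.inl z)) (inLeft_injective s t h)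
        · exact absurd h (inLeft_ne_inRight s t x y)
        · exact absurd h (inRight_ne_root s t x)
        · exact absurd h.symm (inLeft_ne_inRight s t y x)
        · exact congrArg (fun z => Sum.inr (Sum.inr z)) (inRight_injective s t h)
      · rintro (i | _ | p | p)
        · refine Fin.addCases (fun i => ?_) (fun i => ?_) i
          · exact ⟨.inr (.inl (.inl i)), rfl⟩
          · exact ⟨.inr (.inr (.inl i)), rfl⟩
        · exact ⟨.inl (), rfl⟩
        · exact ⟨.inr (.inl (.inr p)), rfl⟩
        · exact ⟨.inr (.inr (.inr p)), rfl⟩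
    have := (hg.comp (Function.bijective_id.sumMap (hs.sumMap ht))).comp hk
    refine Eq.mp (congrArg Function.Bijective ?_) this
    funext x
    rcases x with _ | (_ | p | p) | (_ | p | p) <;> rfl

end PlaneTree

namespace IETData

variable (D : IETData) (s m : PlaneTree D.r)

/-- The edge of the one-foam `closedFoam` below that leads to a leaf or an inner vertex of the
splitting tree. -/
def splitEdge : Fin D.r ⊕ s.Inner → Fin D.r ⊕ (s.Inner ⊕ m.Inner) :=
  Sum.map id Sum.inl

/-- The edge of the one-foam `closedFoam` below that comes from a leaf or an inner vertex of the
merging tree. The strand `i` comes in at the `σ(i)`-th leaf of the merging tree. -/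
def mergeEdge : Fin D.r ⊕ m.Inner → Fin D.r ⊕ (s.Inner ⊕ m.Inner) :=
  Sum.map D.perm.symm Sum.inr

/-- The weights of the edges of the one-foam `closedFoam` below. -/
noncomputable def edgeWeight : Fin D.r ⊕ (s.Inner ⊕ m.Inner) → ℝ :=
  Sum.elim D.len
    (Sum.elim (s.innerWeight D.len) (m.innerWeight fun i => D.len (D.perm.symm i)))

theorem weight_splitEdge (x) : D.edgeWeight s m (D.splitEdge s m x) = s.weight D.len x := by
  rcases x with x | x <;> rfl

theorem weight_mergeEdge (x) : D.edgeWeight s m (D.mergeEdge s m x) =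
    m.weight (fun i => D.len (D.perm.symm i)) x := by
  rcases x with x | x <;> rfl

/-- The closed one-foam of an interval exchange transformation `T_{λ,σ}`: a line of weight `1` is
split into lines of weights `λ_1, …, λ_r`, from left to right, by the sequence of splits that the
tree `s` prescribes; the resulting lines are permuted by `σ` and merged, by the sequence of merges
that the tree `m` prescribes, into a line of weight `1`, the end of which is then joined with the
beginning. The edges are the `r` lines in the middle, the edges that go into the splits and the
edges that come out of the merges; the point where the diagram is closed up is a bivalent point. At
every vertex the order of the two thin edges is from left to right. -/
noncomputable def closedFoam : OneFoam where
  Edge := Fin D.r ⊕ (s.Inner ⊕ m.Inner)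
  Reg := Unit
  Merge := m.Inner
  Split := s.Inner
  weight := D.edgeWeight s m
  weight_pos := by
    rintro (i | p | p)
    · exact D.len_pos i
    · exact s.weight_pos D.len D.len_pos (.inr p)
    · exact m.weight_pos _ (fun i => D.len_pos _) (.inr p)
  regIn := fun _ => D.mergeEdge s m m.root
  regOut := fun _ => D.splitEdge s m s.root
  mergeIn₁ := fun p => D.mergeEdge s m (m.child₁ p)
  mergeIn₂ := fun p => D.mergeEdge s m (m.child₂ p)
  mergeOut := fun p => .inr (.inr p)
  splitIn := fun p => .inr (.inl p)
  splitOut₁ := fun p => D.splitEdge s m (s.child₁ p)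
  splitOut₂ := fun p => D.splitEdge s m (s.child₂ p)
  target_bij := by
    have := (((Equiv.sumAssoc _ _ _).trans
      (Equiv.sumCongr D.perm.symm (Equiv.sumComm m.Inner s.Inner))).bijective.comp
      (m.rootOrChild_bijective.sumMap (Function.bijective_id (α := s.Inner)))).comp
      ((Equiv.sumCongr (Equiv.refl _) (Equiv.sumAssoc _ _ _).symm).trans
        (Equiv.sumAssoc _ _ _).symm).bijective
    refine Eq.mp (congrArg Function.Bijective ?_) this
    funext x
    rcases x with x | x | x | x
    · change _ = D.mergeEdge s m m.root
      simp only [Function.comp, mergeEdge]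
      rcases h : m.root with y | y <;> simp [PlaneTree.rootOrChild, h]
    · change _ = D.mergeEdge s m (m.child₁ x)
      simp only [Function.comp, mergeEdge]
      rcases h : m.child₁ x with y | y <;> simp [PlaneTree.rootOrChild, h]
    · change _ = D.mergeEdge s m (m.child₂ x)
      simp only [Function.comp, mergeEdge]
      rcases h : m.child₂ x with y | y <;> simp [PlaneTree.rootOrChild, h]
    · rfl
  source_bij := by
    have := ((Equiv.sumAssoc (Fin D.r) s.Inner m.Inner).bijective.comp
      (s.rootOrChild_bijective.sumMap (Function.bijective_id (α := m.Inner)))).comp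
      ((Equiv.sumCongr (Equiv.refl _) (Equiv.sumAssoc _ _ _).symm).trans
        (Equiv.sumAssoc _ _ _).symm).bijective
    refine Eq.mp (congrArg Function.Bijective ?_) this
    funext x
    rcases x with x | x | x | x
    · change _ = D.splitEdge s m s.root
      simp only [Function.comp, splitEdge]
      rcases h : s.root with y | y <;> simp [PlaneTree.rootOrChild, h]
    · change _ = D.splitEdge s m (s.child₁ x)
      simp only [Function.comp, splitEdge]
      rcases h : s.child₁ x with y | y <;> simp [PlaneTree.rootOrChild, h]
    · change _ = D.splitEdge s m (s.child₂ x)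
      simp only [Function.comp, splitEdge]
      rcases h : s.child₂ x with y | y <;> simp [PlaneTree.rootOrChild, h]
    · rfl
  reg_weight := fun _ => by
    rw [weight_mergeEdge, weight_splitEdge, PlaneTree.weight_root, PlaneTree.weight_root]
    exact Equiv.sum_comp D.perm.symm D.len
  merge_weight := fun p => by
    rw [weight_mergeEdge, weight_mergeEdge, PlaneTree.weight_child]
    rfl
  split_weight := fun p => by
    rw [weight_splitEdge, weight_splitEdge, PlaneTree.weight_child]
    rfl

end IETData

/-! Every one-foam has a vertex chain: the sum of the pairs (first, second thin weight) over its
splits minus the sum over its merges. A vertex of a two-foam imposes on its four seams exactly the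
two-cocycle relation (a,b) + (a+b,c) = (b,c) + (a,b+c). If a chain lies in the span of these
relations, then the one-foam bounds (`OneFoam.nonempty_twoFoam`): the relations supply the vertices,
seam ends of equal type are paired off, and a single facet serves for each weight, since a facet may
have any number of boundary circles. It therefore suffices to compute in the quotient Q of chains by
relations, where the class of (a,b) is the universal two-cocycle f on the additive semigroup of
positive reals.

The commutator f(a,b) - f(b,a) of a two-cocycle is biadditive and antisymmetric. It extends to the
reals, where it can be halved by halving an argument. Subtracting this half, β, leaves a symmetric
cocycle (`exists_halfCommutator`). A symmetric cocycle defines a commutative extension, and its sum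
over the inner vertices of a tree compares the product of lifts of the leaf weights with the lift of
the total weight. This sum depends neither on the tree nor on the order of the leaves
(`PlaneTree.innerSum_perm`), so it cancels between the splitting and the merging half of a closed
foam.

What remains is the contribution of β, a sum over ordered pairs of strands. It equals the
Sah–Arnoux–Fathi sum of β(length, translation) over the exchanged intervals
(`IETData.exists_vertexChain_eq_safSum`), in which the trees no longer occur. On a common refinement
translations add under composition, so this sum is additive (`IETData.safSum_comp`). That gives the
cobordism, and the homomorphism follows formally. -/

/-! ### Vertex chains of one-foams -/

/-- Positive real numbers, the weights of edges and facets. -/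
abbrev PosWeight : Type := {x : ℝ // 0 < x}

/-- Formal integral combinations of vertex types, that is, of ordered pairs of thin weights. -/
abbrev VertexChain : Type := PosWeight × PosWeight →₀ ℤ

/-- The relation between the four seams at a vertex of a two-foam. -/
noncomputable def assocChain (x : PosWeight × PosWeight × PosWeight) : VertexChain :=
  Finsupp.single (x.1, x.2.1) 1 + Finsupp.single (x.1 + x.2.1, x.2.2) 1 -
    Finsupp.single (x.2.1, x.2.2) 1 - Finsupp.single (x.1, x.2.1 + x.2.2) 1

/-- The span of the vertex relations. -/
noncomputable def assocRelations : AddSubgroup VertexChain :=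
  AddSubgroup.closure (Set.range assocChain)

/-- Positive and negative occurrences of relations are kept in separate families because they become
the two kinds of vertices of a two-foam; a coefficient of larger absolute value is a repetition in a
family. The sign convention is that of `VertN` minus `VertP`. -/
theorem exists_sum_assocChain {x : VertexChain} (hx : x ∈ assocRelations) :
    ∃ (P N : Type) (_ : Fintype P) (_ : Fintype N) (p : P → PosWeight × PosWeight × PosWeight)
      (n : N → PosWeight × PosWeight × PosWeight),
      x = ∑ v, assocChain (n v) - ∑ v, assocChain (p v) := by
  induction hx using AddSubgroup.closure_induction with
  | mem x hx =>
    obtain ⟨t, rfl⟩ := hx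
    exact ⟨Empty, Unit, inferInstance, inferInstance, Empty.elim, fun _ => t, by simp⟩
  | zero => exact ⟨Empty, Empty, inferInstance, inferInstance, Empty.elim, Empty.elim, by simp⟩
  | add x y _ _ hx hy =>
    obtain ⟨P, N, _, _, p, n, rfl⟩ := hx
    obtain ⟨P', N', _, _, p', n', rfl⟩ := hy
    refine ⟨P ⊕ P', N ⊕ N', inferInstance, inferInstance, Sum.elim p p', Sum.elim n n', ?_⟩
    simp only [Fintype.sum_sum_type, Sum.elim_inl, Sum.elim_inr]
    abel
  | neg x _ hx =>
    obtain ⟨P, N, _, _, p, n, rfl⟩ := hx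
    exact ⟨N, P, inferInstance, inferInstance, n, p, by abel⟩

/-- Two finite families with equal sums of basis elements agree up to reindexing. -/
theorem exists_equiv_of_sum_single_eq {α β γ : Type} [Fintype α] [Fintype β] (f : α → γ)
    (g : β → γ)
    (h : ∑ a, Finsupp.single (f a) (1 : ℤ) = ∑ b, Finsupp.single (g b) (1 : ℤ)) :
    ∃ e : α ≃ β, ∀ a, g (e a) = f a := by
  classical
  have key : ∀ c : γ, Nonempty ({a // f a = c} ≃ {b // g b = c}) := by
    intro c
    have hc := DFunLike.congr_fun h c
    -- The coefficient at `c` counts the fibre over `c`, so the fibres on both sides have equal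
    -- cardinality and are matched one by one.
    simp only [Finsupp.finsetSum_apply, Finsupp.single_apply, Finset.sum_boole] at hc
    refine ⟨Fintype.equivOfCardEq ?_⟩
    rw [Fintype.card_subtype, Fintype.card_subtype]
    exact_mod_cast hc
  exact ⟨Equiv.ofFiberEquiv fun c => (key c).some, Equiv.ofFiberEquiv_map _⟩

theorem finsum_sum_type {α β M : Type} [Finite α] [Finite β] [AddCommMonoid M] (f : α ⊕ β → M) :
    ∑ᶠ x, f x = ∑ᶠ a, f (.inl a) + ∑ᶠ b, f (.inr b) := by
  have := Fintype.ofFinite α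
  have := Fintype.ofFinite β
  simp only [finsum_eq_sum_of_fintype, Fintype.sum_sum_type]

namespace OneFoam

variable (U V : OneFoam)

/-- The weight of an edge as a positive real number. -/
def posWeight (e : U.Edge) : PosWeight := ⟨U.weight e, U.weight_pos e⟩

/-- The pair of thin weights at a split. -/
def splitType (s : U.Split) : PosWeight × PosWeight :=
  (U.posWeight (U.splitOut₁ s), U.posWeight (U.splitOut₂ s))

/-- The pair of thin weights at a merge. -/
def mergeType (m : U.Merge) : PosWeight × PosWeight :=
  (U.posWeight (U.mergeIn₁ m), U.posWeight (U.mergeIn₂ m))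

/-- The signed sum of the types of the vertices, splits counted positively. -/
noncomputable def vertexChain : VertexChain :=
  ∑ᶠ s, Finsupp.single (U.splitType s) 1 - ∑ᶠ m, Finsupp.single (U.mergeType m) 1

theorem vertexChain_eq_sum [Fintype U.Split] [Fintype U.Merge] : U.vertexChain =
    ∑ s, Finsupp.single (U.splitType s) 1 - ∑ m, Finsupp.single (U.mergeType m) 1 := by
  rw [vertexChain, finsum_eq_sum_of_fintype, finsum_eq_sum_of_fintype]

theorem vertexChain_reverse : U.reverse.vertexChain = -U.vertexChain := by
  rw [vertexChain, vertexChain, neg_sub]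
  rfl

theorem vertexChain_union : (U.union V).vertexChain = U.vertexChain + V.vertexChain := by
  have hs := finsum_sum_type (α := U.Split) (β := V.Split)
    fun s => Finsupp.single ((U.union V).splitType s) (1 : ℤ)
  have hm := finsum_sum_type (α := U.Merge) (β := V.Merge)
    fun s => Finsupp.single ((U.union V).mergeType s) (1 : ℤ)
  exact (congrArg₂ (· - ·) hs hm).trans (add_sub_add_comm _ _ _ _)

variable {U V}

/-- A one-foam bounds as soon as its vertex chain is a combination of vertex relations: the
relations provide the vertices of a two-foam, the ends of seams of equal type are joined, and there
is one facet for each weight. -/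
theorem nonempty_twoFoam (h : U.vertexChain ∈ assocRelations) : Nonempty (TwoFoam U) := by
  classical
  obtain ⟨P, N, _, _, p, n, hx⟩ := exists_sum_assocChain h
  have : Fintype U.Split := Fintype.ofFinite _
  have : Fintype U.Merge := Fintype.ofFinite _
  -- The types of the seams at their terminal and initial ends, listed in the order of `target_bij`
  -- and `source_bij`. The terminal ends themselves will index the seams, which makes `target_bij`
  -- the identity; `source_bij` is then the matching `e` of initial with terminal ends.
  let terminal : Empty ⊕ (P ⊕ (P ⊕ (N ⊕ (N ⊕ U.Split)))) → PosWeight × PosWeight :=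
    Sum.elim Empty.elim (Sum.elim (fun v => ((p v).1, (p v).2.1))
      (Sum.elim (fun v => ((p v).1 + (p v).2.1, (p v).2.2))
      (Sum.elim (fun v => ((n v).2.1, (n v).2.2))
      (Sum.elim (fun v => ((n v).1, (n v).2.1 + (n v).2.2)) U.splitType))))
  let initial : Empty ⊕ (N ⊕ (N ⊕ (P ⊕ (P ⊕ U.Merge)))) → PosWeight × PosWeight :=
    Sum.elim Empty.elim (Sum.elim (fun v => ((n v).1, (n v).2.1))
      (Sum.elim (fun v => ((n v).1 + (n v).2.1, (n v).2.2))
      (Sum.elim (fun v => ((p v).2.1, (p v).2.2))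
      (Sum.elim (fun v => ((p v).1, (p v).2.1 + (p v).2.2)) U.mergeType))))
  -- The equation `hx`, with the negative terms moved across, says that every type occurs equally
  -- often among initial and terminal ends.
  obtain ⟨e, he⟩ := exists_equiv_of_sum_single_eq initial terminal (by
    rw [U.vertexChain_eq_sum] at hx
    simp only [assocChain, Finset.sum_add_distrib, Finset.sum_sub_distrib] at hx
    simp only [initial, terminal, Fintype.sum_sum_type, Sum.elim_inl, Sum.elim_inr,
      Finset.univ_eq_empty, Finset.sum_empty, zero_add]
    rw [sub_eq_iff_eq_add] at hx
    rw [hx]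
    abel)
  let seamThick := fun s => (terminal s).1 + (terminal s).2
  -- The weights of all sides, along the boundary or along a seam. Facets are the finitely many
  -- values of this function, so by `heq` every matching condition reduces to an equality of
  -- weights.
  let all := Sum.elim U.posWeight (Sum.elim (fun s => (terminal s).1)
    (Sum.elim (fun s => (terminal s).2) seamThick))
  have heq : ∀ x y, all x = all y → Set.rangeFactorization all x = Set.rangeFactorization all y :=
    fun x y hxy => Subtype.ext hxy
  refine ⟨{
    Facet := Set.range all
    Seam := Empty ⊕ (P ⊕ (P ⊕ (N ⊕ (N ⊕ U.Split))))
    Point := Empty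
    VertP := P
    VertN := N
    genus := fun _ => 0
    weight := fun f => f.1.1
    weight_pos := fun f => f.1.2
    thin₁ := fun s => Set.rangeFactorization all (.inr (.inl s))
    thin₂ := fun s => Set.rangeFactorization all (.inr (.inr (.inl s)))
    thick := fun s => Set.rangeFactorization all (.inr (.inr (.inr s)))
    seam_weight := fun s => rfl
    side := fun s => Set.rangeFactorization all (.inl s)
    side_weight := fun s => rfl
    pointIn := Empty.elim
    pointOut := Empty.elim
    aP := fun v => .inr (.inl v)
    cP := fun v => .inr (.inr (.inl v))
    bN := fun v => .inr (.inr (.inr (.inl v)))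
    dN := fun v => .inr (.inr (.inr (.inr (.inl v))))
    atSplit := fun v => .inr (.inr (.inr (.inr (.inr v))))
    aN := fun v => e (.inr (.inl v))
    cN := fun v => e (.inr (.inr (.inl v)))
    bP := fun v => e (.inr (.inr (.inr (.inl v))))
    dP := fun v => e (.inr (.inr (.inr (.inr (.inl v)))))
    atMerge := fun v => e (.inr (.inr (.inr (.inr (.inr v)))))
    target_bij := ?_
    source_bij := ?_
    point_match := fun v => v.elim
    vertP_match := ?_
    vertN_match := ?_
    reg_match := ?_
    merge_match := ?_
    split_match := ?_ }⟩
  · refine Eq.mp (congrArg Function.Bijective ?_) Function.bijective_id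
    funext x
    rcases x with x | x | x | x | x | x <;> first | rfl | exact x.elim
  · refine Eq.mp (congrArg Function.Bijective ?_) e.bijective
    funext x
    rcases x with x | x | x | x | x | x <;> first | rfl | exact x.elim
  · intro v
    -- The seams `a` and `c` end here, so their types are read off directly; `b` and `d` start here,
    -- and their types are known through the matching. The last condition, on the thick facets of
    -- `c` and `d`, is associativity of addition.
    have hb := he (.inr (.inr (.inr (.inl v))))
    have hd := he (.inr (.inr (.inr (.inr (.inl v)))))
    refine ⟨heq _ _ ?_, heq _ _ ?_, heq _ _ ?_, heq _ _ ?_, heq _ _ ?_, heq _ _ ?_⟩ <;>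
      simp [all, seamThick, hb, hd, terminal, initial, add_assoc]
  · intro v
    have ha := he (.inr (.inl v))
    have hc := he (.inr (.inr (.inl v)))
    refine ⟨heq _ _ ?_, heq _ _ ?_, heq _ _ ?_, heq _ _ ?_, heq _ _ ?_, heq _ _ ?_⟩ <;>
      simp [all, seamThick, ha, hc, terminal, initial, add_assoc]
  · intro r
    exact heq _ _ (Subtype.ext (U.reg_weight r))
  · intro m
    have hm := he (.inr (.inr (.inr (.inr (.inr m)))))
    refine ⟨heq _ _ ?_, heq _ _ ?_, heq _ _ ?_⟩
    · simp [all, hm, initial, mergeType]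
    · simp [all, hm, initial, mergeType]
    · simp only [all, seamThick, hm, initial, Sum.elim_inl, Sum.elim_inr]
      exact Subtype.ext (U.merge_weight m).symm
  · intro s
    refine ⟨heq _ _ rfl, heq _ _ rfl, heq _ _ (Subtype.ext (U.split_weight s).symm)⟩

/-- One-foams with the same vertex chain modulo the vertex relations are cobordant. -/
theorem cobordant_of_vertexChain
    (h : (U.vertexChain : VertexChain ⧸ assocRelations) = V.vertexChain) : Cobordant U V := by
  refine nonempty_twoFoam ?_
  rw [vertexChain_union, vertexChain_reverse]
  exact QuotientAddGroup.eq.1 h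

end OneFoam

/-! ### Commutators of two-cocycles -/

section Cocycle

variable {M : Type} [AddCommGroup M]

/-- An additive function on the positive reals extends to the reals. -/
theorem exists_addMonoidHom_extend (f : PosWeight → M) (h : ∀ a b, f (a + b) = f a + f b) :
    ∃ g : ℝ →+ M, ∀ a : PosWeight, g a = f a := by
  -- The reals are the group of differences of positive reals; this is well-definedness on
  -- differences.
  have key : ∀ p q p' q' : PosWeight, (p : ℝ) - q = p' - q' → f p - f q = f p' - f q' := by
    intro p q p' q' hpq
    have : p + q' = p' + q := Subtype.ext (by
      change (p : ℝ) + q' = p' + q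
      linarith)
    rw [sub_eq_sub_iff_add_eq_add, ← h, ← h, this]
  -- An explicit way to write `x` as a difference of two positive numbers; the summand 1 secures
  -- positivity at `x = 0`.
  let num : ℝ → PosWeight := fun x => ⟨x + |x| + 1, by linarith [neg_abs_le x]⟩
  let den : ℝ → PosWeight := fun x => ⟨|x| + 1, by positivity⟩
  have hnd : ∀ x, (num x : ℝ) - den x = x := fun x => by
    change x + |x| + 1 - (|x| + 1) = x
    ring
  refine ⟨AddMonoidHom.mk' (fun x => f (num x) - f (den x)) fun x y => ?_, fun a => ?_⟩
  · rw [sub_add_sub_comm, ← h, ← h]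
    refine key _ _ _ _ ?_
    change _ = (num x + num y : ℝ) - (den x + den y)
    linarith [hnd x, hnd y, hnd (x + y)]
  · change f (num a) - f (den a) = f a
    rw [key _ _ (a + a) a, h, add_sub_cancel_right]
    change _ = (a + a : ℝ) - a
    linarith [hnd a]

/-- The positive reals generate the additive group of the reals: both `|x| + 1` and `x + (|x| + 1)`
are positive. -/
theorem addMonoidHom_ext_pos {f g : ℝ →+ M} (h : ∀ a : PosWeight, f a = g a) : f = g := by
  ext x
  have h1 := h ⟨|x| + 1, by positivity⟩
  have h2 := h ⟨x + (|x| + 1), by linarith [neg_abs_le x]⟩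
  simp only [map_add f x, map_add g x] at h2
  rw [h1] at h2
  exact add_right_cancel h2

/-- The commutator pairing of a two-cocycle on the positive reals is biadditive and alternating,
extends to the reals and can be divided by two there. -/
theorem exists_halfCommutator (f : PosWeight → PosWeight → M)
    (hf : ∀ a b c, f a b + f (a + b) c = f b c + f a (b + c)) :
    ∃ β : ℝ →+ ℝ →+ M, (∀ x y, β x y = -β y x) ∧
      ∀ a b : PosWeight, f a b - β a b = f b a - β b a := by
  -- In a central extension of a commutative semigroup commutators are multiplicative in each
  -- variable. In terms of the cocycle this is the combination of the identities for (a,b,c),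
  -- (c,a,b) and (a,c,b).
  have hadd : ∀ a b c, f (a + b) c - f c (a + b) = (f a c - f c a) + (f b c - f c b) := by
    intro a b c
    have h1 := hf a b c
    have h2 := hf c a b
    have h3 := hf a c b
    rw [add_comm c a] at h2
    rw [add_comm c b] at h3
    linear_combination (norm := module) h1 + h2 - h3
  have hadd' : ∀ a b c, f c (a + b) - f (a + b) c = (f c a - f a c) + (f c b - f b c) := by
    intro a b c
    linear_combination (norm := module) -hadd a b c
  -- Extension in one variable at a time: first the second variable, for each fixed positive `a`,
  -- then the first, with values in homomorphisms.
  choose g hg using fun a => exists_addMonoidHom_extend (fun b => f a b - f b a)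
    fun b c => hadd' b c a
  obtain ⟨B, hB⟩ := exists_addMonoidHom_extend g fun a b => addMonoidHom_ext_pos fun c => by
    rw [AddMonoidHom.add_apply, hg, hg, hg, hadd]
  have hBpos : ∀ a b : PosWeight, B a b = f a b - f b a := fun a b => by rw [hB, hg]
  have hflip : B = -B.flip := addMonoidHom_ext_pos fun a => addMonoidHom_ext_pos fun b => by
    change B a b = -B b a
    rw [hBpos, hBpos, neg_sub]
  have hanti : ∀ x y, B x y = -B y x := fun x y => by
    conv_lhs => rw [hflip]
    rfl
  have htwo : ∀ x y, B x (y / 2) + B x (y / 2) = B x y := fun x y => by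
    rw [← map_add, add_halves]
  -- Elements of `M` need not be divisible by 2, but real arguments are. Halving either argument
  -- gives the same value, so the half of `B` inherits antisymmetry.
  have hhalf : ∀ x y, B x (y / 2) = B (x / 2) y := fun x y => by
    have h1 : B x (y / 2) = B (x / 2) (y / 2) + B (x / 2) (y / 2) := by
      rw [← AddMonoidHom.add_apply, ← map_add, add_halves]
    rw [h1, htwo]
  -- The witness is `B x (y / 2)`. Its antisymmetrisation is `B`, the commutator of `f`, which is
  -- why subtracting it makes `f` symmetric.
  refine ⟨B.compr₂ (AddMonoidHom.id M) |>.compl₂ (AddMonoidHom.mulRight (2⁻¹ : ℝ)), ?_, ?_⟩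
  · intro x y
    change B x (y * 2⁻¹) = -B y (x * 2⁻¹)
    rw [← div_eq_mul_inv, ← div_eq_mul_inv, hhalf, hanti]
  · intro a b
    change f a b - B a (b * 2⁻¹) = f b a - B b (a * 2⁻¹)
    rw [← div_eq_mul_inv, ← div_eq_mul_inv]
    have h1 := htwo a b
    have h2 : B b (a / 2) = -B a (b / 2) := by rw [hhalf, hanti]
    rw [h2]
    rw [hBpos] at h1
    linear_combination (norm := module) -h1

/-- A symmetric two-cocycle on the positive reals defines a commutative extension. -/
theorem exists_commMonoid_extension (ω : PosWeight → PosWeight → M) (hs : ∀ a b, ω a b = ω b a)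
    (hω : ∀ a b c, ω a b + ω (a + b) c = ω b c + ω a (b + c)) :
    ∃ (C : Type) (_ : CommMonoid C) (κ : M → PosWeight → C),
      (∀ x y a b, κ x a * κ y b = κ (x + y + ω a b) (a + b)) ∧
      ∀ x y a, κ x a = κ y a → x = y := by
  -- The product twisted by `ω`: the cocycle identity is associativity, symmetry is commutativity.
  let inst : CommSemigroup (M × PosWeight) :=
    { mul := fun p q => (p.1 + q.1 + ω p.2 q.2, p.2 + q.2)
      mul_assoc := fun p q r => by
        refine Prod.ext ?_ (add_assoc _ _ _)
        change p.1 + q.1 + ω p.2 q.2 + r.1 + ω (p.2 + q.2) r.2 =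
          p.1 + (q.1 + r.1 + ω q.2 r.2) + ω p.2 (q.2 + r.2)
        linear_combination (norm := module) hω p.2 q.2 r.2
      mul_comm := fun p q => by
        refine Prod.ext ?_ (add_comm _ _)
        change p.1 + q.1 + ω p.2 q.2 = q.1 + p.1 + ω q.2 p.2
        rw [hs, add_comm p.1] }
  -- There is no element of weight 0, so a unit is adjoined to allow finite products.
  refine ⟨WithOne (M × PosWeight), inferInstance, fun x a => ((x, a) : M × PosWeight), ?_, ?_⟩
  · intro x y a b
    exact (WithOne.coe_mul _ _).symm
  · intro x y a h
    exact congrArg Prod.fst (WithOne.coe_inj.1 h)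

end Cocycle

/-! ### Sums over the inner vertices of plane trees -/

namespace PlaneTree

variable {M : Type} [AddCommGroup M]

/-- The sum of a function of the weights of the two children over all inner vertices. -/
noncomputable def innerSum (G : ℝ → ℝ → M) {n : ℕ} (t : PlaneTree n) (w : Fin n → ℝ) : M :=
  ∑ᶠ p, G (t.weight w (t.child₁ p)) (t.weight w (t.child₂ p))

theorem innerSum_leaf (G : ℝ → ℝ → M) (w : Fin 1 → ℝ) : leaf.innerSum G w = 0 :=
  finsum_of_isEmpty (α := Empty) _

theorem innerSum_node (G : ℝ → ℝ → M) {m n : ℕ} (s : PlaneTree m) (t : PlaneTree n)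
    (w : Fin (m + n) → ℝ) : (node s t).innerSum G w =
      G (∑ i, w (Fin.castAdd n i)) (∑ i, w (Fin.natAdd m i)) +
        (s.innerSum G (fun i => w (Fin.castAdd n i)) +
          t.innerSum G (fun i => w (Fin.natAdd m i))) := by
  have := Fintype.ofFinite s.Inner
  have := Fintype.ofFinite t.Inner
  refine (finsum_eq_sum_of_fintype (α := Option (s.Inner ⊕ t.Inner)) _).trans ?_
  rw [Fintype.sum_option, Fintype.sum_sum_type, innerSum, innerSum, finsum_eq_sum_of_fintype,
    finsum_eq_sum_of_fintype, ← weight_root s, ← weight_root t]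
  simp only [← weight_inLeft s t w, ← weight_inRight s t w]
  rfl

theorem innerSum_sub (G H : ℝ → ℝ → M) {n : ℕ} (t : PlaneTree n) (w : Fin n → ℝ) :
    t.innerSum (fun a b => G a b - H a b) w = t.innerSum G w - t.innerSum H w :=
  finsum_sub_distrib (Set.toFinite _) (Set.toFinite _)

/-- Two leaves are separated at exactly one inner vertex, their lowest common ancestor. Expanding
`β` there by biadditivity yields every pair of leaves once, the left one in the first argument. -/
theorem innerSum_biadditive (β : ℝ →+ ℝ →+ M) {n : ℕ} (t : PlaneTree n) (w : Fin n → ℝ) :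
    t.innerSum (fun a b => β a b) w = ∑ i, ∑ j, if i < j then β (w i) (w j) else 0 := by
  induction t with
  | leaf => simp [innerSum_leaf]
  | @node m n s t hs ht =>
    have h1 : ∀ (i j : Fin m), Fin.castAdd n i < Fin.castAdd n j ↔ i < j := fun _ _ => Iff.rfl
    have h2 : ∀ (i : Fin m) (j : Fin n), Fin.castAdd n i < Fin.natAdd m j := fun i j => by
      simp only [Fin.lt_def, Fin.val_castAdd, Fin.val_natAdd]
      omega
    have h3 : ∀ (i : Fin m) (j : Fin n), ¬ Fin.natAdd m j < Fin.castAdd n i := fun i j =>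
      (h2 i j).asymm
    have h4 : ∀ (i j : Fin n), Fin.natAdd m i < Fin.natAdd m j ↔ i < j := fun i j => by
      simp only [Fin.lt_def, Fin.val_natAdd]
      omega
    rw [innerSum_node, hs, ht]
    simp only [Fin.sum_univ_add, h1, h2, h3, h4, if_true, if_false, map_sum,
      AddMonoidHom.finsetSum_apply, Finset.sum_add_distrib, Finset.sum_const_zero]
    rw [Finset.sum_comm]
    abel

/-- The sum of a symmetric two-cocycle over the inner vertices of a tree depends neither on the
tree nor on the order of the leaves. -/
theorem innerSum_perm (G : ℝ → ℝ → M) (hs : ∀ a b : PosWeight, G a b = G b a)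
    (hG : ∀ a b c : PosWeight, G a b + G (a + b) c = G b c + G a (b + c)) {n : ℕ}
    (s t : PlaneTree n) (w : Fin n → ℝ) (hw : ∀ i, 0 < w i) (σ : Equiv.Perm (Fin n)) :
    t.innerSum G (fun i => w (σ i)) = s.innerSum G w := by
  obtain ⟨C, _, κ, hκ, hinj⟩ := exists_commMonoid_extension (fun a b => G a b) hs hG
  -- Multiplying the lifts `κ 0 (w i)` along the tree collects one cocycle value at each inner
  -- vertex. The product in a commutative monoid sees neither the bracketing nor the order. The
  -- total weight is a separate variable `a` so that its positivity need not be carried in the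
  -- formula.
  have key : ∀ {n : ℕ} (t : PlaneTree n) (w : Fin n → PosWeight) (a : PosWeight),
      (a : ℝ) = ∑ i, (w i : ℝ) → κ (t.innerSum G fun i => w i) a = ∏ i, κ 0 (w i) := by
    intro n t
    induction t with
    | leaf =>
      intro w a ha
      rw [innerSum_leaf, Fin.prod_univ_one, show a = w 0 from Subtype.ext (by simpa using ha)]
    | @node m n s t ihs iht =>
      intro w a ha
      have := s.nonempty
      have := t.nonempty
      let b : PosWeight := ⟨∑ i, (w (Fin.castAdd n i) : ℝ),
        Finset.sum_pos (fun i _ => (w _).2) Finset.univ_nonempty⟩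
      let c : PosWeight := ⟨∑ i, (w (Fin.natAdd m i) : ℝ),
        Finset.sum_pos (fun i _ => (w _).2) Finset.univ_nonempty⟩
      have habc : a = b + c := Subtype.ext (ha.trans (Fin.sum_univ_add _))
      rw [Fin.prod_univ_add, ← ihs _ b rfl, ← iht _ c rfl, hκ, habc, innerSum_node]
      congr 1
      exact add_comm _ _
  have hpos : 0 < ∑ i, w i := by
    have := s.nonempty
    exact Finset.sum_pos (fun i _ => hw i) Finset.univ_nonempty
  refine hinj _ _ ⟨∑ i, w i, hpos⟩ ?_
  rw [key s (fun i => ⟨w i, hw i⟩) _ rfl,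
    key t (fun i => ⟨w (σ i), hw _⟩) _ (Equiv.sum_comp σ w).symm]
  exact Equiv.prod_comp σ fun i => κ 0 ⟨w i, hw i⟩

end PlaneTree

/-! ### The class of the one-foam of an interval exchange transformation -/

/-- The class of a seam with given thin weights modulo the vertex relations, with value `0` outside
the positive quadrant. -/
noncomputable def seamClass (a b : ℝ) : VertexChain ⧸ assocRelations :=
  open Classical in
  if h : 0 < a ∧ 0 < b then
    ((Finsupp.single (⟨a, h.1⟩, ⟨b, h.2⟩) 1 : VertexChain) : VertexChain ⧸ assocRelations)
  else 0

theorem seamClass_pos (a b : PosWeight) : seamClass a b =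
    ((Finsupp.single (a, b) 1 : VertexChain) : VertexChain ⧸ assocRelations) :=
  dif_pos ⟨a.2, b.2⟩

/-- This is the cocycle identity, valid because the vertex relations have been divided out. -/
theorem seamClass_assoc (a b c : PosWeight) :
    seamClass a b + seamClass (a + b) c = seamClass b c + seamClass a (b + c) := by
  have h : ((assocChain (a, b, c) : VertexChain) : VertexChain ⧸ assocRelations) = 0 :=
    (QuotientAddGroup.eq_zero_iff _).2 (AddSubgroup.subset_closure ⟨_, rfl⟩)
  have h1 : seamClass (a + b) c = _ := seamClass_pos (a + b) c
  have h2 : seamClass a (b + c) = _ := seamClass_pos a (b + c)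
  rw [h1, h2, seamClass_pos, seamClass_pos, ← sub_eq_zero, ← h, assocChain]
  simp only [QuotientAddGroup.mk_add, QuotientAddGroup.mk_sub]
  abel

namespace IETData

variable (D : IETData) (s m : PlaneTree D.r)

/-- The splits contribute the splitting tree with leaf weights in the original order, the merges the
merging tree with leaf weights in the permuted order; all weights are positive, so the default value
of `seamClass` does not enter. -/
theorem vertexChain_closedFoam :
    ((D.closedFoam s m).vertexChain : VertexChain ⧸ assocRelations) =
      s.innerSum seamClass D.len - m.innerSum seamClass fun i => D.len (D.perm.symm i) := by
  have hS := Fintype.ofFinite (D.closedFoam s m).Split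
  have hM := Fintype.ofFinite (D.closedFoam s m).Merge
  rw [OneFoam.vertexChain_eq_sum, QuotientAddGroup.mk_sub]
  refine congrArg₂ (· - ·) ?_ ?_
  · refine (map_sum (QuotientAddGroup.mk' assocRelations) _ _).trans ?_
    rw [← finsum_eq_sum_of_fintype]
    refine finsum_congr fun p => ?_
    rw [← D.weight_splitEdge s m, ← D.weight_splitEdge s m]
    exact (seamClass_pos _ _).symm
  · refine (map_sum (QuotientAddGroup.mk' assocRelations) _ _).trans ?_
    rw [← finsum_eq_sum_of_fintype]
    refine finsum_congr fun p => ?_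
    rw [← D.weight_mergeEdge s m, ← D.weight_mergeEdge s m]
    exact (seamClass_pos _ _).symm

/-- The translation by which the `i`-th interval is moved. -/
noncomputable def shift (i : Fin D.r) : ℝ := D.left D.perm i - D.left 1 i

/-- The Sah–Arnoux–Fathi sum of an interval exchange transformation, for a biadditive pairing. -/
noncomputable def safSum {M : Type} [AddCommGroup M] (β : ℝ →+ ℝ →+ M) : M :=
  ∑ i, β (D.len i) (D.shift i)

/-- A left end is the sum of the lengths of the intervals before it. Expanding it turns the pairing
with lengths into a sum over pairs of intervals, with the later one in the first argument;
antisymmetry reverses the pair and produces the sign. -/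
theorem safSum_eq {M : Type} [AddCommGroup M] (β : ℝ →+ ℝ →+ M) (hβ : ∀ x y, β x y = -β y x) :
    D.safSum β = ∑ i, ∑ j, (if i < j then β (D.len i) (D.len j) else 0) -
      ∑ i, ∑ j, (if i < j then β (D.len (D.perm.symm i)) (D.len (D.perm.symm j)) else 0) := by
  -- To be used for `D.perm` and for the identity, the two terms of `shift`.
  have h1 : ∀ τ : Equiv.Perm (Fin D.r), ∑ i, β (D.len i) (D.left τ i) =
      -∑ i, ∑ j, (if i < j then β (D.len (τ.symm i)) (D.len (τ.symm j)) else 0) := by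
    intro τ
    have h2 : ∑ i, ∑ j, (if i < j then β (D.len (τ.symm i)) (D.len (τ.symm j)) else 0) =
        ∑ i, ∑ j, (if τ i < τ j then β (D.len i) (D.len j) else 0) := by
      rw [← Equiv.sum_comp τ]
      refine Finset.sum_congr rfl fun i _ => ?_
      rw [← Equiv.sum_comp τ]
      simp
    rw [h2, Finset.sum_comm, ← Finset.sum_neg_distrib]
    refine Finset.sum_congr rfl fun i _ => ?_
    rw [left, map_sum, Finset.sum_filter, ← Finset.sum_neg_distrib]
    refine Finset.sum_congr rfl fun j _ => ?_
    split_ifs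
    · exact hβ _ _
    · exact neg_zero.symm
  simp only [safSum, shift, map_sub, Finset.sum_sub_distrib, h1]
  rw [sub_neg_eq_add, neg_add_eq_sub]
  rfl

/-- The vertex chain of the closed one-foam, modulo the vertex relations, is given by the
Sah–Arnoux–Fathi sum. -/
theorem exists_vertexChain_eq_safSum :
    ∃ β : ℝ →+ ℝ →+ (VertexChain ⧸ assocRelations), ∀ (D : IETData) (s m : PlaneTree D.r),
      ((D.closedFoam s m).vertexChain : VertexChain ⧸ assocRelations) = D.safSum β := by
  obtain ⟨β, hanti, hsymm⟩ := exists_halfCommutator (fun a b => seamClass a b) seamClass_assoc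
  refine ⟨β, fun D s m => ?_⟩
  -- A biadditive map is a two-cocycle, so the difference is one as well, and it is symmetric by the
  -- choice of `β`. Hence the splitting and the merging tree have the same sum for it, and only the
  -- two `β` sums survive.
  have hinv := PlaneTree.innerSum_perm (fun a b => seamClass a b - β a b) hsymm (fun a b c => by
    have := seamClass_assoc a b c
    simp only [map_add, AddMonoidHom.add_apply]
    linear_combination (norm := module) this) s m D.len D.len_pos D.perm.symm
  rw [PlaneTree.innerSum_sub, PlaneTree.innerSum_sub, PlaneTree.innerSum_biadditive,
    PlaneTree.innerSum_biadditive] at hinv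
  rw [vertexChain_closedFoam, safSum_eq D β hanti]
  linear_combination (norm := module) -hinv

end IETData

/-! ### Additivity of the Sah–Arnoux–Fathi sum -/

open MeasureTheory in
/-- A finite measurable partition of a set of finite measure. -/
theorem sum_measureReal_inter {ι : Type} [Fintype ι] (B : ι → Set ℝ)
    (hB : ∀ i, MeasurableSet (B i)) {S : Set ℝ} (hS : MeasurableSet S) (hfin : volume S ≠ ⊤)
    (h : ∀ x ∈ S, ∃! i, x ∈ B i) : ∑ i, volume.real (S ∩ B i) = volume.real S := by
  have hU : S = ⋃ i ∈ (Finset.univ : Finset ι), S ∩ B i := by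
    ext x
    simp only [Finset.mem_univ, Set.iUnion_true, Set.mem_iUnion, Set.mem_inter_iff]
    exact ⟨fun hx => (h x hx).exists.imp fun i hi => ⟨hx, hi⟩, fun ⟨_, hi⟩ => hi.1⟩
  conv_rhs => rw [hU]
  refine (measureReal_biUnion_finset ?_ (fun i _ => hS.inter (hB i)) fun i _ => ?_).symm
  · intro i _ j _ hij
    refine Set.disjoint_left.2 fun x hi hj => hij ?_
    exact (h x hi.1).unique hi.2 hj.2
  · exact measure_ne_top_of_subset Set.inter_subset_left hfin

namespace IETData

open MeasureTheory

variable (D : IETData)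

/-- The `i`-th interval when the intervals are put in the order that `τ` prescribes. -/
def block (τ : Equiv.Perm (Fin D.r)) (i : Fin D.r) : Set ℝ :=
  Set.Ico (D.left τ i) (D.left τ i + D.len i)

theorem measurableSet_block (τ : Equiv.Perm (Fin D.r)) (i : Fin D.r) :
    MeasurableSet (D.block τ i) := measurableSet_Ico

theorem volume_block (τ : Equiv.Perm (Fin D.r)) (i : Fin D.r) :
    volume.real (D.block τ i) = D.len i := by
  rw [block, Real.volume_real_Ico_of_le (by linarith [D.len_pos i]), add_sub_cancel_left]

theorem block_subset (τ : Equiv.Perm (Fin D.r)) (i : Fin D.r) :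
    D.block τ i ⊆ Set.Ico 0 1 :=
  Set.Ico_subset_Ico (D.left_nonneg τ i) (D.left_add_len_le_one τ i)

theorem place_eq_of_mem_block {τ : Equiv.Perm (Fin D.r)} {i : Fin D.r} {x : Set.Ico (0 : ℝ) 1}
    (hx : (x : ℝ) ∈ D.block τ i) : D.place τ ⟨i, ⟨x - D.left τ i, by linarith [hx.1], by
      linarith [hx.2]⟩⟩ = x :=
  Subtype.ext (by simp [place])

theorem existsUnique_block (τ : Equiv.Perm (Fin D.r)) {x : ℝ} (hx : x ∈ Set.Ico (0 : ℝ) 1) :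
    ∃! i, x ∈ D.block τ i := by
  obtain ⟨⟨i, y⟩, hp⟩ := (D.place_bijective τ).2 ⟨x, hx⟩
  have hv : D.left τ i + y = x := congrArg Subtype.val hp
  refine ⟨i, ⟨by linarith [y.2.1], by linarith [y.2.2]⟩, fun j hj => ?_⟩
  have := D.place_eq_of_mem_block (x := ⟨x, hx⟩) hj
  exact congrArg Sigma.fst ((D.place_bijective τ).1 (this.trans hp.symm))

theorem map_of_mem_block {i : Fin D.r} {x : Set.Ico (0 : ℝ) 1} (hx : (x : ℝ) ∈ D.block 1 i) :
    (D.map x : ℝ) = x + D.shift i := by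
  conv_lhs => rw [← D.place_eq_of_mem_block hx, D.map_place]
  simp only [place, shift]
  ring

/-- The map translates the `i`-th interval onto its new position; translation invariance of length
is applied through this identity. -/
theorem preimage_block_perm (i : Fin D.r) :
    (fun x => x + D.shift i) ⁻¹' D.block D.perm i = D.block 1 i := by
  ext x
  simp only [block, shift, Set.mem_preimage, Set.mem_Ico]
  constructor <;> rintro ⟨h1, h2⟩ <;> constructor <;> linarith

theorem sum_volume_inter_block (τ : Equiv.Perm (Fin D.r)) {S : Set ℝ} (hS : MeasurableSet S)
    (h : S ⊆ Set.Ico 0 1) : ∑ i, volume.real (S ∩ D.block τ i) = volume.real S :=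
  sum_measureReal_inter _ (D.measurableSet_block τ) hS
    (measure_ne_top_of_subset h (by simp)) fun _ hx => D.existsUnique_block τ (h hx)

/-- All three sums are expanded over one common refinement of `[0,1)`. On each nonempty piece the
translation of the composite is the sum of the two translations. Since `β` is additive but need not
be continuous, it matters that every length is a finite sum of lengths of pieces. -/
theorem safSum_comp {M : Type} [AddCommGroup M] (β : ℝ →+ ℝ →+ M) (D D' D'' : IETData)
    (h : D''.map = D'.map ∘ D.map) : D''.safSum β = D.safSum β + D'.safSum β := by
  -- the common refinement
  let T : Fin D.r → Fin D'.r → Set ℝ := fun i j => (fun x => x + D.shift i) ⁻¹' D'.block 1 j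
  -- The total length of the points that lie in the `i`-th interval of `D` and the `k`-th of `D''`,
  -- and that `D.map` sends into the `j`-th interval of `D'`. Lebesgue measure avoids an enumeration
  -- of the pieces by their end points.
  let ν : Fin D.r → Fin D'.r → Fin D''.r → ℝ := fun i j k =>
    volume.real (D.block 1 i ∩ D''.block 1 k ∩ T i j)
  have hT : ∀ i j, MeasurableSet (T i j) := fun i j =>
    (D'.measurableSet_block 1 j).preimage (measurable_add_const _)
  have hmem : ∀ i x, x ∈ D.block 1 i → x + D.shift i ∈ Set.Ico (0 : ℝ) 1 := fun i x hx => by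
    rw [← D.map_of_mem_block (x := ⟨x, D.block_subset 1 i hx⟩) hx]
    exact (D.map _).2
  have hj : ∀ i k, ∑ j, ν i j k = volume.real (D.block 1 i ∩ D''.block 1 k) := fun i k =>
    sum_measureReal_inter (T i) (hT i)
      ((D.measurableSet_block 1 i).inter (D''.measurableSet_block 1 k))
      (measure_ne_top_of_subset (Set.inter_subset_left.trans (D.block_subset 1 i)) (by simp))
      fun x hx => D'.existsUnique_block 1 (hmem i x hx.1)
  have hlen : ∀ i, ∑ k, ∑ j, ν i j k = D.len i := fun i => by
    simp only [hj]
    rw [D''.sum_volume_inter_block 1 (D.measurableSet_block 1 i) (D.block_subset 1 i),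
      volume_block]
  have hlen'' : ∀ k, ∑ i, ∑ j, ν i j k = D''.len k := fun k => by
    simp only [hj, Set.inter_comm _ (D''.block 1 k)]
    rw [D.sum_volume_inter_block 1 (D''.measurableSet_block 1 k) (D''.block_subset 1 k),
      volume_block]
  -- The intervals of `D'` subdivide the image of `D.map`, so each piece is moved there by its
  -- translation, which preserves measure; the moved intervals of `D` partition `[0,1)`.
  have hlen' : ∀ j, ∑ i, ∑ k, ν i j k = D'.len j := fun j => by
    have h1 : ∀ i, ∑ k, ν i j k = volume.real (D'.block 1 j ∩ D.block D.perm i) := fun i => by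
      have h2 := D''.sum_volume_inter_block 1 ((D.measurableSet_block 1 i).inter (hT i j))
        (Set.inter_subset_left.trans (D.block_subset 1 i))
      rw [← D.preimage_block_perm i, ← Set.preimage_inter, Set.inter_comm, measureReal_def,
        measure_preimage_add_right, ← measureReal_def] at h2
      rw [← h2]
      refine Finset.sum_congr rfl fun k _ => ?_
      rw [Set.preimage_inter, D.preimage_block_perm, Set.inter_comm (_ ⁻¹' _),
        Set.inter_right_comm]
    simp only [h1]
    rw [D.sum_volume_inter_block D.perm (D'.measurableSet_block 1 j) (D'.block_subset 1 j),
      volume_block]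
  have hshift : ∀ i j k, β (ν i j k) (D''.shift k) =
      β (ν i j k) (D.shift i) + β (ν i j k) (D'.shift j) := fun i j k => by
    -- On an empty piece both sides vanish; otherwise evaluating the maps at one of its points
    -- compares the translations.
    rcases (D.block 1 i ∩ D''.block 1 k ∩ T i j).eq_empty_or_nonempty with h0 | ⟨x, ⟨hx, hx''⟩, hx'⟩
    · simp [ν, h0]
    · let y : Set.Ico (0 : ℝ) 1 := ⟨x, D.block_subset 1 i hx⟩
      have h1 := D.map_of_mem_block (x := y) hx
      have h2 := D''.map_of_mem_block (x := y) hx''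
      have h3 := D'.map_of_mem_block (x := D.map y) (i := j) (by rw [h1]; exact hx')
      have h4 : D''.map y = D'.map (D.map y) := congrFun h y
      rw [h4] at h2
      rw [← map_add, show D''.shift k = D.shift i + D'.shift j by linarith]
  have e : D.safSum β = ∑ i, ∑ k, ∑ j, β (ν i j k) (D.shift i) := by
    simp only [safSum, ← hlen, map_sum, AddMonoidHom.finsetSum_apply]
  have e' : D'.safSum β = ∑ j, ∑ i, ∑ k, β (ν i j k) (D'.shift j) := by
    simp only [safSum, ← hlen', map_sum, AddMonoidHom.finsetSum_apply]
  have e'' : D''.safSum β = ∑ k, ∑ i, ∑ j, β (ν i j k) (D''.shift k) := by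
    simp only [safSum, ← hlen'', map_sum, AddMonoidHom.finsetSum_apply]
  rw [e, e', e'']
  simp only [hshift, Finset.sum_add_distrib]
  congr 1
  · exact Finset.sum_comm
  · rw [Finset.sum_comm, Finset.sum_comm (γ := Fin D'.r)]
    refine Finset.sum_congr rfl fun i _ => Finset.sum_comm

end IETData

/-! ### The homomorphism to the cobordism group -/

theorem PlaneTree.nonempty_of_pos {n : ℕ} (hn : 0 < n) : Nonempty (PlaneTree n) := by
  induction n, hn using Nat.le_induction with
  | base => exact ⟨.leaf⟩
  | succ n _ ih => exact ih.map fun t => .node t .leaf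

theorem IETData.r_pos (D : IETData) : 0 < D.r := by
  refine Nat.pos_of_ne_zero fun h => ?_
  have : IsEmpty (Fin D.r) := by rw [h]; infer_instance
  simpa using D.len_sum

namespace IETData

theorem cobordant_comp (D D' D'' : IETData) (h : D''.map = D'.map ∘ D.map)
    (s m : PlaneTree D.r) (s' m' : PlaneTree D'.r) (s'' m'' : PlaneTree D''.r) :
    Cobordant (D''.closedFoam s'' m'') ((D.closedFoam s m).union (D'.closedFoam s' m')) := by
  obtain ⟨β, hβ⟩ := exists_vertexChain_eq_safSum
  refine OneFoam.cobordant_of_vertexChain ?_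
  rw [OneFoam.vertexChain_union, QuotientAddGroup.mk_add, hβ, hβ, hβ, safSum_comp β D D' D'' h]

theorem mk_comp (D D' D'' : IETData) (h : D''.map = D'.map ∘ D.map)
    (s m : PlaneTree D.r) (s' m' : PlaneTree D'.r) (s'' m'' : PlaneTree D''.r) :
    Cob.mk (D''.closedFoam s'' m'') =
      Cob.mk (D.closedFoam s m) + Cob.mk (D'.closedFoam s' m') :=
  Quotient.sound (cobordant_comp D D' D'' h s m s' m' s'' m'')

/-- The identity is its own square, so its class is equal to its double. -/
theorem mk_eq_zero (D : IETData) (h : D.map = 1) (s m : PlaneTree D.r) :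
    Cob.mk (D.closedFoam s m) = 0 :=
  add_eq_left.1 (mk_comp D D D (by rw [h]; rfl) s m s m s m).symm

/-- The class depends only on the map: `D.map` is `D'.map` followed by the identity, and data for
the identity have class zero. -/
theorem mk_congr (D D' : IETData) (h : D.map = D'.map) (s m : PlaneTree D.r)
    (s' m' : PlaneTree D'.r) : Cob.mk (D.closedFoam s m) = Cob.mk (D'.closedFoam s' m') := by
  obtain ⟨I, hI⟩ := AutIET.one_mem
  obtain ⟨t⟩ := PlaneTree.nonempty_of_pos I.r_pos
  rw [mk_comp D' I D (by rw [hI, h]; rfl) s' m' t t s m, mk_eq_zero I hI, add_zero]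

end IETData

theorem mainTheorem10 :
    (∀ (D D' D'' : IETData), D''.map = D'.map ∘ D.map →
      ∀ (s m : PlaneTree D.r) (s' m' : PlaneTree D'.r) (s'' m'' : PlaneTree D''.r),
        Cobordant (D''.closedFoam s'' m'')
          ((D.closedFoam s m).union (D'.closedFoam s' m'))) ∧
    ∃ φ : AutIET →* Multiplicative Cob, ∀ (D : IETData) (s m : PlaneTree D.r),
      φ D.toAut = Multiplicative.ofAdd (Cob.mk (D.closedFoam s m)) := by
  refine ⟨IETData.cobordant_comp, ?_⟩
  -- Arbitrary data and trees are chosen for each map; `IETData.mk_congr` makes the choice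
  -- irrelevant.
  choose E hE using fun f : AutIET => f.2
  let t := fun f => (PlaneTree.nonempty_of_pos (E f).r_pos).some
  refine ⟨MonoidHom.mk' (fun f => Multiplicative.ofAdd (Cob.mk ((E f).closedFoam (t f) (t f))))
    fun f g => ?_, fun D s m => ?_⟩
  · rw [← ofAdd_add]
    refine congrArg Multiplicative.ofAdd ?_
    -- The product `f * g` applies `g` first, so `IETData.mk_comp` yields the class of `g` as the
    -- first summand.
    rw [add_comm]
    refine IETData.mk_comp _ _ _ ?_ _ _ _ _ _ _
    rw [hE, hE, hE]
    rfl
  · exact congrArg Multiplicative.ofAdd (IETData.mk_congr _ _ (hE _) _ _ _ _)
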